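/- Fix $0<q<1$ and $\lambda>0$. Let $T$ be the edge-weighted Galton--Watson tree with root $\phi$ in which the offspring of every vertex are given by an independent inhomogeneous Poisson process on $[0,\lambda]$ with intensity $q x^{q-1}\,dx$, each point of the process giving one child, joined by an edge whose cost $\ell$ is that point. A valuation of $T$ is a function $f:V(T)\to[-\lambda/2,\lambda/2]$ such that, for every vertex $u$, $$f(u)=\min\Big(\frac{\lambda}{2},\ \min_{v\text{ child of }u}\big(\ell(u,v)-f(v)\big)\Big),$$ so that $f(u)=\lambda/2$ if $u$ is a leaf. Let $f_A$ be the extremal valuation: $f_A(u)$ is the infimum of $f(u)$ over all valuations $f$ if $u$ is at even distance from $\phi$, and the supremum if $u$ is at odd distance. For a vertex $v$ with parent $u$ put $\delta(v)=\ell(u,v)-f_A(u)-f_A(v)$. A path $\phi=u_0\to u_1\to\dots\to u_n$ directed away from the root is called $(\phi,t)$-reasonable if $\sum_{i=1}^n\delta(u_i)\le t$ and $\delta(u_i)=0$ for all odd $i$. Let $\Delta_t$ be the union of all $(\phi,t)$-reasonable paths, let $\Delta_t^k$ be its truncation to the first $k$ levels, and let $|\Delta_t^k|$ be the number of edges of $\Delta_t^k$.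 Define, for $z\in[-\lambda/2,\lambda/2]$, $$R_t^k(z)=\mathbb E\big[\,|\Delta_t^k|\ \big|\ f_A(\phi)=z\,\big]:=\limsup_{\varepsilon\downarrow0}\ \mathbb E\big[\,|\Delta_t^k|\ \big|\ |f_A(\phi)-z|\le\varepsilon\,\big].$$ Then: (1) for all $k\in\mathbb N$ and $t\in[0,2\lambda]$, $R^k_t$ is a version of the conditional expectation of $|\Delta_t^k|$ given $f_A(\phi)$, that is, $\mathbb E\big[|\Delta_t^k|\,\mathbf 1_{\{f_A(\phi)\in B\}}\big]=\mathbb E\big[R_t^k(f_A(\phi))\,\mathbf 1_{\{f_A(\phi)\in B\}}\big]$ for every Borel set $B$ (the random variables $|\Delta_t^k|$ and $f_A(\phi)$, and the function $R_t^k$, being measurable up to null sets); (2) there exist continuous functions $\Psi_t:[-\lambda/2,\lambda/2]\to\mathbb R$, $t\in[0,2\lambda]$, with $\sup_{z,t}\Psi_t(z)<\infty$, such that $R_t^{2k}(z)<\Psi_t(z)$ for all $z\in[-\lambda/2,\lambda/2]$, $t\in[0,2\lambda]$ and $k\in\mathbb N$; (3) almost surely, $\Delta_t$ is finite for every $t\in[0,2\lambda]$;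 in particular $\Delta_\lambda$ and $\Delta_{2\lambda}$ are almost surely finite. -/

import Mathlib

open MeasureTheory ProbabilityTheory Set Filter Topology
open scoped ENNReal NNReal

noncomputable section

namespace Exploration

/-! ### The random edge-weighted tree

Potential vertices are words `u : List ℕ`. The root is `[]` and `i :: u` is the `i`-th child of `u`,
so the suffixes of a word are exactly the vertices on the path from the root to it, and the length
of a word is its distance from the root. -/

/-- The data that determine an edge-weighted rooted tree: `(ω u).1` is the number of children of the
vertex `u`, and `(ω u).2 i` is the cost of the edge from `u` to its `i`-th child
(relevant only for `i < (ω u).1`). -/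
abbrev TreeData : Type := List ℕ → ℕ × (ℕ → ℝ)

/-- The number of children of `u`. -/
def numChildren (ω : TreeData) (u : List ℕ) : ℕ := (ω u).1

/-- The cost of the edge from `u` to its child `i :: u`. -/
def edgeCost (ω : TreeData) (u : List ℕ) (i : ℕ) : ℝ := (ω u).2 i

/-- `IsVertex ω u` says that the word `u` is a vertex of the tree given by `ω`. -/
def IsVertex (ω : TreeData) : List ℕ → Prop
  | [] => True
  | i :: u => IsVertex ω u ∧ i < numChildren ω u

/-- The intensity measure `q t ^ (q - 1) dt` on `[0, lam]`. -/
def intensity (q lam : ℝ) : Measure ℝ :=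
  (volume.restrict (Icc 0 lam)).withDensity fun t => ENNReal.ofReal (q * t ^ (q - 1))

/-- The normalized intensity measure, i.e. the law of each point of the Poisson process given the
number of points. -/
def costLaw (q lam : ℝ) : Measure ℝ := (intensity q lam univ)⁻¹ • intensity q lam

/-- The law of the offspring of one vertex: a Poisson process with the given intensity measure,
realized as a Poisson number of points placed independently with the normalized intensity. -/
def offspringLaw (q lam : ℝ) : Measure (ℕ × (ℕ → ℝ)) :=
  (poissonMeasure (intensity q lam univ).toNNReal).prod
    (Measure.infinitePi fun _ : ℕ => costLaw q lam)

/-- The law of the Galton-Watson tree with Poisson process offspring: all vertices produce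
offspring independently, with the same law. -/
def treeLaw (q lam : ℝ) : Measure TreeData :=
  Measure.infinitePi fun _ : List ℕ => offspringLaw q lam

theorem intensity_univ {q lam : ℝ} (hq : 0 < q) (hlam : 0 < lam) :
    intensity q lam univ = ENNReal.ofReal (lam ^ q) := by
  have hint : IntervalIntegrable (fun t : ℝ => q * t ^ (q - 1)) volume 0 lam :=
    (intervalIntegral.intervalIntegrable_rpow' (by linarith)).const_mul q
  rw [intensity, withDensity_apply _ MeasurableSet.univ, Measure.restrict_univ,
    ← restrict_Ioc_eq_restrict_Icc, ← ofReal_integral_eq_lintegral_ofReal]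
  · rw [← intervalIntegral.integral_of_le hlam.le, intervalIntegral.integral_const_mul,
      integral_rpow (Or.inl (by linarith))]
    congr 1
    simp only [sub_add_cancel, Real.zero_rpow hq.ne', sub_zero]
    field_simp
  · exact (intervalIntegrable_iff_integrableOn_Ioc_of_le hlam.le).1 hint
  · refine (ae_restrict_iff' measurableSet_Ioc).2 (Eventually.of_forall fun t ht => ?_)
    exact mul_nonneg hq.le (Real.rpow_nonneg ht.1.le _)

/-- `treeLaw q lam` is indeed a probability measure. -/
theorem isProbabilityMeasure_treeLaw {q lam : ℝ} (hq : 0 < q) (hlam : 0 < lam) :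
    IsProbabilityMeasure (treeLaw q lam) := by
  have h0 : intensity q lam univ ≠ 0 := by
    rw [intensity_univ hq hlam]
    simpa using Real.rpow_pos_of_pos hlam q
  have h1 : intensity q lam univ ≠ ∞ := by
    rw [intensity_univ hq hlam]; exact ENNReal.ofReal_ne_top
  have : IsProbabilityMeasure (costLaw q lam) :=
    ⟨by simpa [costLaw] using ENNReal.inv_mul_cancel h0 h1⟩
  have : IsProbabilityMeasure (offspringLaw q lam) := by
    unfold offspringLaw; infer_instance
  unfold treeLaw; infer_instance

/-! ### Valuations of the game -/

/-- `f` is a game valuation on the tree `ω`: it takes values in `[-lam/2, lam/2]`, and at every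
vertex `u` its value is the minimum of the penalty `lam / 2` (for quitting) and of the numbers
`ℓ(u, v) - f v` over all children `v` of `u`. In particular it is `lam / 2` at the leaves. -/
def IsValuation (lam : ℝ) (ω : TreeData) (f : List ℕ → ℝ) : Prop :=
  ∀ u, IsVertex ω u → f u ∈ Icc (-(lam / 2)) (lam / 2) ∧
    IsLeast (insert (lam / 2)
      {x | ∃ i < numChildren ω u, x = edgeCost ω u i - f (i :: u)}) (f u)

/-- The extremal valuation `f_A`: the smallest possible value at vertices at even distance from
the root, the largest possible value at vertices at odd distance. -/
def fA (lam : ℝ) (ω : TreeData) (u : List ℕ) : ℝ :=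
  if Even u.length then sInf {x | ∃ f, IsValuation lam ω f ∧ x = f u}
  else sSup {x | ∃ f, IsValuation lam ω f ∧ x = f u}

/-- The value `f_A(φ)` of the root. -/
def rootValue (lam : ℝ) (ω : TreeData) : ℝ := fA lam ω []

/-! ### Reasonable paths -/

/-- `deviation lam ω v` is `δ(v) = ℓ(u, v) - f_A(u) - f_A(v)`, where `u` is the parent of `v`
(and `0` at the root). -/
def deviation (lam : ℝ) (ω : TreeData) : List ℕ → ℝ
  | [] => 0
  | i :: u => edgeCost ω u i - fA lam ω u - fA lam ω (i :: u)

/-- The path in the tree from the root to `v` is `(φ, t)`-reasonable: the sum of the deviations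
along it is at most `t`, and the deviation is `0` at its vertices at odd distance from the root. -/
def IsReasonable (lam : ℝ) (ω : TreeData) (t : ℝ) (v : List ℕ) : Prop :=
  IsVertex ω v ∧ (v.tails.map (deviation lam ω)).sum ≤ t ∧
    ∀ w, w <:+ v → Odd w.length → deviation lam ω w = 0

/-- The vertex set of the tree `Δ_t(φ)`, the union of all `(φ, t)`-reasonable paths. (The finite
initial pieces of an infinite reasonable path are finite reasonable paths, deviations being
nonnegative, so infinite paths contribute nothing new.) -/
def reasonableTree (lam : ℝ) (ω : TreeData) (t : ℝ) : Set (List ℕ) :=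
  {u | ∃ v, IsReasonable lam ω t v ∧ u <:+ v}

/-- The number of edges of the `k`-level truncation `Δ_t^k(φ)`. An edge is counted through its
endpoint further from the root. -/
def truncSize (lam : ℝ) (k : ℕ) (t : ℝ) (ω : TreeData) : ℝ≥0∞ :=
  (({u ∈ reasonableTree lam ω t | u ≠ [] ∧ u.length ≤ k}.encard : ℕ∞) : ℝ≥0∞)

/-! ### Conditional expectations given the value of a real random variable -/

/-- The conditional expectation `E[X | Y = z]`, as the (upper) limit as `ε ↓ 0` of the elementary
conditional expectations `E[X | |Y - z| ≤ ε]`. -/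
def condMeanAt {Ω : Type*} [MeasurableSpace Ω] (P : Measure Ω) (X : Ω → ℝ≥0∞) (Y : Ω → ℝ)
    (z : ℝ) : ℝ≥0∞ :=
  limsup (fun ε : ℝ => (∫⁻ ω in {ω | |Y ω - z| ≤ ε}, X ω ∂P) / P {ω | |Y ω - z| ≤ ε}) (𝓝[>] 0)

/-- `g` is a version of `z ↦ E[X | Y = z]` in the measure-theoretic sense. -/
def IsCondMean {Ω : Type*} [MeasurableSpace Ω] (P : Measure Ω) (X : Ω → ℝ≥0∞) (Y : Ω → ℝ)
    (g : ℝ → ℝ≥0∞) : Prop :=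
  AEMeasurable X P ∧ AEMeasurable Y P ∧ AEMeasurable g (P.map Y) ∧
    ∀ B, MeasurableSet B → ∫⁻ ω in Y ⁻¹' B, X ω ∂P = ∫⁻ z in B, g z ∂(P.map Y)

/-- `R_t^k(z) = E[ |Δ_t^k(φ)| | f_A(φ) = z ]`. -/
def meanSize (q lam : ℝ) (k : ℕ) (t z : ℝ) : ℝ≥0∞ :=
  condMeanAt (treeLaw q lam) (truncSize lam k t) (rootValue lam) z

end Exploration

end

noncomputable section

namespace Exploration

/-! ### Product measures: splitting off one coordinate -/

/-! The extremal valuation is a limit of finite games. Cutting the tree at level `k` and giving the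
cut vertices the values `-lam / 2` or `lam / 2` yields monotone bounds on the value of the root;
their limits `value lam false` and `value lam true` satisfy the game recursion with the type
switched at every generation, and `fA_eq_alternatingValue` identifies `fA` with them. The Mecke
formula (`mecke`, `mecke_value`) then makes a child tractable: its cost, its subtree and the value
that the root has without it can be integrated against a product measure.

Paths are counted by a Chernoff bound. If an allowed deviation `d` gets the weight `exp (-θ d)`, the
number of reasonable paths with budget `t` is at most `exp (θ t)` times the total weight `pathSum`
(`truncSize_le`). The core is `exists_lintegral_pathSum_le`: the mean of `pathSum` times `h (value)`
is at most `C` times the mean of `h (value)` on the event that quitting is not optimal, uniformly in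
the number of levels and in `h`. Indicators of intervals for `h` bound all elementary conditional
means at once, so no density of the root value is needed and `Ψ` can be constant; `h = 1` and
monotone convergence give finiteness. The first claim is differentiation of measures.

For the core bound, steps are of two kinds. Along steps of deviation zero, `lintegral_sum_optimal`
transports `h` to the child by the operator `childOp`. Almost surely there is at most one such
child, and none when quitting is optimal, so mass does not grow. A loss uniform in `h` comes from
`exists_iterOp_contraction`: the kernel of `childOp` has a singularity of order `q - 1`, which
finitely many compositions remove (`exists_iterOp_le`), so late mass is at most a multiple of an
integral of `h`; a multiple of the same integral bounds from below the mass lost after one step at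
children whose value is `lam / 2`. A step of positive deviation decouples the child from the value
of the root and costs a factor `η` (`lintegral_sum_discounted_le`), small for large `θ`
(`exists_discount`). The contraction leaves room for these extra terms, and a strong induction on
the number of levels closes. -/

theorem infinitePi_option {α E : Type*} [MeasurableSpace E] (μ : Measure E)
    [IsProbabilityMeasure μ] :
    (Measure.infinitePi fun _ : Option α => μ) =
      (μ.prod (Measure.infinitePi fun _ : α => μ)).map
        (fun p (o : Option α) => o.elim p.1 p.2) := by
  classical
  have hm : Measurable (fun (p : E × (α → E)) (o : Option α) => o.elim p.1 p.2) := by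
    refine measurable_pi_iff.2 fun o => ?_
    cases o with
    | none => exact measurable_fst
    | some i => exact (measurable_pi_apply i).comp measurable_snd
  refine (Measure.eq_infinitePi _ fun s t ht => ?_).symm
  rw [Measure.map_apply hm (.pi s.countable_toSet fun _ _ => ht _)]
  have hpre : (fun (p : E × (α → E)) (o : Option α) => o.elim p.1 p.2) ⁻¹' Set.pi (↑s) t =
      (if none ∈ s then t none else univ) ×ˢ
        Set.pi (↑(Finset.eraseNone s)) (fun i => t (some i)) := by
    ext p
    simp only [mem_preimage, Set.mem_pi, mem_prod, Finset.mem_coe, Option.forall,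
      Option.elim_none, Option.elim_some, Finset.mem_eraseNone]
    split_ifs with h <;> simp [h]
  rw [hpre, Measure.prod_prod, Measure.infinitePi_pi _ (fun i _ => ht _)]
  by_cases h : none ∈ s
  · have hs : s = insert none ((Finset.eraseNone s).map Function.Embedding.some) := by
      ext o; cases o <;> simp [h]
    conv_rhs => rw [hs]
    rw [Finset.prod_insert (by simp), Finset.prod_map, if_pos h]
    rfl
  · have hs : s = (Finset.eraseNone s).map Function.Embedding.some := by
      ext o; cases o <;> simp [h]
    conv_rhs => rw [hs]
    rw [Finset.prod_map, if_neg h, measure_univ, one_mul]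
    rfl

/-- Under an infinite product measure, one coordinate and any family of other coordinates are
independent. -/
theorem infinitePi_map_split {ι α E : Type*} [MeasurableSpace E] (μ : Measure E)
    [IsProbabilityMeasure μ] (i : ι) (f : α → ι) (hf : Function.Injective f)
    (hi : ∀ j, f j ≠ i) :
    (Measure.infinitePi fun _ : ι => μ).map (fun x => (x i, fun j => x (f j))) =
      μ.prod (Measure.infinitePi fun _ : α => μ) := by
  have hinj : Function.Injective (fun o : Option α => o.elim i f) := by
    intro o o' h
    cases o with
    | none => cases o' with
      | none => rfl
      | some j => exact absurd h.symm (hi j)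
    | some j => cases o' with
      | none => exact absurd h (hi j)
      | some j' => exact congrArg some (hf h)
  have h1 := Measure.map_infinitePi_infinitePi_of_inj (P := fun _ : ι => μ) hinj
  have hm : Measurable (fun (p : E × (α → E)) (o : Option α) => o.elim p.1 p.2) := by
    refine measurable_pi_iff.2 fun o => ?_
    cases o with
    | none => exact measurable_fst
    | some i => exact (measurable_pi_apply i).comp measurable_snd
  have hm' : Measurable (fun (y : Option α → E) => (y none, fun j : α => y (some j))) := by
    fun_prop
  have h2 : (Measure.infinitePi fun _ : ι => μ).map (fun x => (x i, fun j => x (f j))) =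
      ((Measure.infinitePi fun _ : ι => μ).map (fun x o => x (Option.elim o i f))).map
        (fun (y : Option α → E) => (y none, fun j : α => y (some j))) := by
    rw [Measure.map_map hm' (by fun_prop)]
    rfl
  rw [h2, h1, infinitePi_option, Measure.map_map hm' hm]
  exact Measure.map_id

/-! ### Subtrees -/

/-- The subtree of `ω` rooted at the `i`-th child of the root. -/
def subtree (ω : TreeData) (i : ℕ) : TreeData := fun v => ω (v ++ [i])

/-- The map of `ℕ` onto `ℕ \ {i}` that preserves the order. -/
def skip (i j : ℕ) : ℕ := if j < i then j else j + 1

theorem skip_injective (i : ℕ) : Function.Injective (skip i) := by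
  intro j k h
  simp only [skip] at h
  split_ifs at h <;> omega

theorem skip_ne (i j : ℕ) : skip i j ≠ i := by
  simp only [skip]; split_ifs <;> omega

theorem costLaw_isProbabilityMeasure {q lam : ℝ} (hq : 0 < q) (hlam : 0 < lam) :
    IsProbabilityMeasure (costLaw q lam) := by
  have h0 : intensity q lam univ ≠ 0 := by
    rw [intensity_univ hq hlam]
    simpa using Real.rpow_pos_of_pos hlam q
  have h1 : intensity q lam univ ≠ ∞ := by
    rw [intensity_univ hq hlam]; exact ENNReal.ofReal_ne_top
  exact ⟨by simpa [costLaw] using ENNReal.inv_mul_cancel h0 h1⟩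

theorem offspringLaw_isProbabilityMeasure {q lam : ℝ} (hq : 0 < q) (hlam : 0 < lam) :
    IsProbabilityMeasure (offspringLaw q lam) := by
  have := costLaw_isProbabilityMeasure hq hlam
  unfold offspringLaw; infer_instance

@[fun_prop]
theorem measurable_subtree (i : ℕ) : Measurable (fun ω : TreeData => subtree ω i) := by
  unfold subtree
  exact measurable_pi_iff.2 fun v => measurable_pi_apply _

/-- The branching property: the offspring of the root and the subtrees at the children are
independent, and each subtree has the law of the whole tree. -/
theorem treeLaw_map_branching {q lam : ℝ} (hq : 0 < q) (hlam : 0 < lam) :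
    (treeLaw q lam).map (fun ω => (ω [], subtree ω)) =
      (offspringLaw q lam).prod (Measure.infinitePi fun _ : ℕ => treeLaw q lam) := by
  have := offspringLaw_isProbabilityMeasure hq hlam
  have hinj : Function.Injective (fun p : ℕ × List ℕ => p.2 ++ [p.1]) := by
    rintro ⟨i, v⟩ ⟨j, w⟩ h
    have := List.append_inj' h rfl
    simp only [List.cons.injEq, and_true] at this
    exact Prod.ext this.2 this.1
  have h1 := infinitePi_map_split (offspringLaw q lam) ([] : List ℕ) _ hinj (by simp)
  have h2 := Measure.infinitePi_map_curry (ι := ℕ) (κ := List ℕ)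
    (fun _ _ => offspringLaw q lam)
  have h3 : (treeLaw q lam).map (fun ω => (ω [], subtree ω)) =
      ((treeLaw q lam).map (fun ω => (ω [], fun p : ℕ × List ℕ => ω (p.2 ++ [p.1])))).map
        (Prod.map id (MeasurableEquiv.curry ℕ (List ℕ) (ℕ × (ℕ → ℝ)))) := by
    rw [Measure.map_map (measurable_id.prodMap (MeasurableEquiv.measurable _)) (by fun_prop)]
    rfl
  rw [h3, treeLaw, h1, ← Measure.map_prod_map _ _ measurable_id (MeasurableEquiv.measurable _),
    Measure.map_id, h2]

theorem lintegral_treeLaw {q lam : ℝ} (hq : 0 < q) (hlam : 0 < lam)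
    {F : (ℕ × (ℕ → ℝ)) × (ℕ → TreeData) → ℝ≥0∞} (hF : Measurable F) :
    ∫⁻ ω, F (ω [], subtree ω) ∂(treeLaw q lam) =
      ∫⁻ p, F p ∂((offspringLaw q lam).prod
        (Measure.infinitePi fun _ : ℕ => treeLaw q lam)) := by
  rw [← treeLaw_map_branching hq hlam, lintegral_map hF]
  exact (measurable_pi_apply _).prodMk (measurable_pi_iff.2 fun i => measurable_subtree i)

theorem lintegral_infinitePi_split {E : Type*} [MeasurableSpace E] (μ : Measure E)
    [IsProbabilityMeasure μ] (i : ℕ) {F : E × (ℕ → E) → ℝ≥0∞} (hF : Measurable F) :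
    ∫⁻ x, F (x i, fun j => x (skip i j)) ∂(Measure.infinitePi fun _ : ℕ => μ) =
      ∫⁻ y, ∫⁻ x, F (y, x) ∂(Measure.infinitePi fun _ : ℕ => μ) ∂μ := by
  rw [← lintegral_prod _ hF.aemeasurable,
    ← infinitePi_map_split μ i (skip i) (skip_injective i) (skip_ne i),
    lintegral_map hF (by fun_prop)]

/-! ### Poisson offspring and the Mecke formula. -/

theorem lintegral_poissonMeasure (r : ℝ≥0) (f : ℕ → ℝ≥0∞) :
    ∫⁻ n, f n ∂(poissonMeasure r) =
      ∑' n : ℕ, ENNReal.ofReal (Real.exp (-r) * r ^ n / (n.factorial : ℝ)) * f n := by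
  rw [poissonMeasure, lintegral_sum_measure]
  simp [lintegral_smul_measure]

/-- Size-biasing a Poisson variable. -/
theorem lintegral_poissonMeasure_mul (r : ℝ≥0) (f : ℕ → ℝ≥0∞) :
    ∫⁻ n, n * f (n - 1) ∂(poissonMeasure r) = r * ∫⁻ n, f n ∂(poissonMeasure r) := by
  rw [lintegral_poissonMeasure, lintegral_poissonMeasure, tsum_eq_zero_add' ENNReal.summable,
    ← ENNReal.tsum_mul_left]
  simp only [Nat.cast_zero, zero_mul, mul_zero, zero_add, Nat.add_sub_cancel]
  congr 1
  ext n
  rw [← mul_assoc, ← mul_assoc]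
  congr 1
  rw [← ENNReal.ofReal_natCast, ← ENNReal.ofReal_coe_nnreal, ← ENNReal.ofReal_mul (by positivity),
    ← ENNReal.ofReal_mul (by positivity)]
  congr 1
  rw [Nat.factorial_succ]
  push_cast
  field_simp
  ring

theorem intensity_eq_smul_costLaw {q lam : ℝ} (hq : 0 < q) (hlam : 0 < lam) :
    intensity q lam = ((intensity q lam univ).toNNReal : ℝ≥0∞) • costLaw q lam := by
  have h0 : intensity q lam univ ≠ 0 := by
    rw [intensity_univ hq hlam]
    simpa using Real.rpow_pos_of_pos hlam q
  have h1 : intensity q lam univ ≠ ∞ := by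
    rw [intensity_univ hq hlam]; exact ENNReal.ofReal_ne_top
  rw [ENNReal.coe_toNNReal h1, costLaw, smul_smul, ENNReal.mul_inv_cancel h0 h1, one_smul]

/-- The Mecke formula for the Poisson process of children of the root, marked by their subtrees. -/
theorem mecke {q lam : ℝ} (hq : 0 < q) (hlam : 0 < lam)
    {F : ℝ → TreeData → (ℕ × (ℕ → ℝ)) × (ℕ → TreeData) → ℝ≥0∞}
    (hF : Measurable fun p : ℝ × TreeData × ((ℕ × (ℕ → ℝ)) × (ℕ → TreeData)) =>
      F p.1 p.2.1 p.2.2) :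
    ∫⁻ ω, ∑ i ∈ Finset.range (numChildren ω []), F (edgeCost ω [] i) (subtree ω i)
        ((numChildren ω [] - 1, fun j => edgeCost ω [] (skip i j)), fun j => subtree ω (skip i j))
          ∂(treeLaw q lam) =
      ∫⁻ x, ∫⁻ ω', ∫⁻ ω, F x ω' (ω [], subtree ω) ∂(treeLaw q lam) ∂(treeLaw q lam)
        ∂(intensity q lam) := by
  have := isProbabilityMeasure_treeLaw hq hlam
  have := offspringLaw_isProbabilityMeasure hq hlam
  have := costLaw_isProbabilityMeasure hq hlam
  set r := (intensity q lam univ).toNNReal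
  set T := Measure.infinitePi fun _ : ℕ => treeLaw q lam
  set K := Measure.infinitePi fun _ : ℕ => costLaw q lam
  have hterm : ∀ i, Measurable fun p : (ℕ × (ℕ → ℝ)) × (ℕ → TreeData) =>
      F (p.1.2 i) (p.2 i) ((p.1.1 - 1, fun j => p.1.2 (skip i j)), fun j => p.2 (skip i j)) := by
    intro i
    have : Measurable fun p : (ℕ × (ℕ → ℝ)) × (ℕ → TreeData) =>
      (p.1.2 i, p.2 i, ((p.1.1 - 1, fun j => p.1.2 (skip i j)), fun j => p.2 (skip i j))) := by
      have : Measurable fun p : (ℕ × (ℕ → ℝ)) × (ℕ → TreeData) => p.1.1 - 1 :=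
        (measurable_from_top (f := fun n : ℕ => n - 1)).comp (measurable_fst.comp measurable_fst)
      fun_prop
    exact hF.comp this
  have hsum : Measurable fun p : (ℕ × (ℕ → ℝ)) × (ℕ → TreeData) =>
      ∑ i ∈ Finset.range p.1.1, F (p.1.2 i) (p.2 i)
        ((p.1.1 - 1, fun j => p.1.2 (skip i j)), fun j => p.2 (skip i j)) := by
    have : Measurable fun p : ℕ × ((ℕ × (ℕ → ℝ)) × (ℕ → TreeData)) =>
      ∑ i ∈ Finset.range p.1, F (p.2.1.2 i) (p.2.2 i)
        ((p.2.1.1 - 1, fun j => p.2.1.2 (skip i j)), fun j => p.2.2 (skip i j)) :=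
      measurable_from_prod_countable_right fun n =>
        Finset.measurable_sum (Finset.range n) fun i _ => hterm i
    exact this.comp (f := fun p : (ℕ × (ℕ → ℝ)) × (ℕ → TreeData) => (p.1.1, p)) (by fun_prop)
  have hL := lintegral_treeLaw hq hlam hsum
  simp only [numChildren, edgeCost] at hL ⊢
  rw [hL]
  have hF3 : ∀ n, Measurable fun p : ℝ × TreeData × ((ℕ → ℝ) × (ℕ → TreeData)) =>
      F p.1 p.2.1 ((n, p.2.2.1), p.2.2.2) := fun n =>
    hF.comp (f := fun p : ℝ × TreeData × ((ℕ → ℝ) × (ℕ → TreeData)) =>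
      (p.1, p.2.1, ((n, p.2.2.1), p.2.2.2))) (by fun_prop)
  -- The contribution of one distinguished child in the presence of `n` others.
  set H : ℕ → ℝ≥0∞ := fun n => ∫⁻ x, ∫⁻ ω', ∫⁻ l, ∫⁻ t, F x ω' ((n, l), t) ∂T ∂K ∂(treeLaw q lam)
    ∂(costLaw q lam) with hH
  -- Costs and subtrees are i.i.d., so the contribution of a child does not depend on its index.
  have hone : ∀ n i, ∫⁻ l, ∫⁻ t, F (l i) (t i)
      ((n - 1, fun j => l (skip i j)), fun j => t (skip i j)) ∂T ∂K = H (n - 1) := by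
    intro n i
    have e1 : ∀ l : ℕ → ℝ, ∫⁻ t, F (l i) (t i)
        ((n - 1, fun j => l (skip i j)), fun j => t (skip i j)) ∂T =
        ∫⁻ ω', ∫⁻ t, F (l i) ω' ((n - 1, fun j => l (skip i j)), t) ∂T ∂(treeLaw q lam) := by
      intro l
      exact lintegral_infinitePi_split (treeLaw q lam) i
        (F := fun p => F (l i) p.1 ((n - 1, fun j => l (skip i j)), p.2))
        ((hF3 (n - 1)).comp (f := fun p : TreeData × (ℕ → TreeData) =>
          (l i, p.1, ((fun j => l (skip i j)), p.2))) (by fun_prop))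
    simp only [e1]
    have m1 : Measurable fun p : ℝ × (ℕ → ℝ) =>
        ∫⁻ ω', ∫⁻ t, F p.1 ω' ((n - 1, p.2), t) ∂T ∂(treeLaw q lam) := by
      refine Measurable.lintegral_prod_right' (f := fun z : (ℝ × (ℕ → ℝ)) × TreeData =>
        ∫⁻ t, F z.1.1 z.2 ((n - 1, z.1.2), t) ∂T) ?_
      refine Measurable.lintegral_prod_right'
        (f := fun z : ((ℝ × (ℕ → ℝ)) × TreeData) × (ℕ → TreeData) =>
        F z.1.1.1 z.1.2 ((n - 1, z.1.1.2), z.2)) ?_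
      exact (hF3 (n - 1)).comp (f := fun z : ((ℝ × (ℕ → ℝ)) × TreeData) × (ℕ → TreeData) =>
          (z.1.1.1, z.1.2, (z.1.1.2, z.2))) (by fun_prop)
    rw [lintegral_infinitePi_split (costLaw q lam) i
      (F := fun p => ∫⁻ ω', ∫⁻ t, F p.1 ω' ((n - 1, p.2), t) ∂T ∂(treeLaw q lam)) m1, hH]
    refine lintegral_congr fun x => ?_
    rw [lintegral_lintegral_swap]
    refine Measurable.aemeasurable ?_
    refine Measurable.lintegral_prod_right'
        (f := fun z : ((ℕ → ℝ) × TreeData) × (ℕ → TreeData) =>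
        F x z.1.2 ((n - 1, z.1.1), z.2)) ?_
    exact (hF3 (n - 1)).comp (f := fun z : ((ℕ → ℝ) × TreeData) × (ℕ → TreeData) =>
          (x, z.1.2, (z.1.1, z.2))) (by fun_prop)
  have hL2 : ∀ n i, Measurable fun p : (ℕ → ℝ) × (ℕ → TreeData) =>
      F (p.1 i) (p.2 i) ((n - 1, fun j => p.1 (skip i j)), fun j => p.2 (skip i j)) := by
    intro n i
    exact (hF3 (n - 1)).comp (f := fun p : (ℕ → ℝ) × (ℕ → TreeData) =>
      (p.1 i, p.2 i, ((fun j => p.1 (skip i j)), fun j => p.2 (skip i j)))) (by fun_prop)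
  have step1 : ∫⁻ p, ∑ i ∈ Finset.range p.1.1, F (p.1.2 i) (p.2 i)
        ((p.1.1 - 1, fun j => p.1.2 (skip i j)), fun j => p.2 (skip i j))
          ∂((offspringLaw q lam).prod T) = ∫⁻ n, n * H (n - 1) ∂(poissonMeasure r) := by
    rw [lintegral_prod _ hsum.aemeasurable, offspringLaw, lintegral_prod]
    · refine lintegral_congr fun n => ?_
      have e2 : ∀ l : ℕ → ℝ, ∫⁻ t, ∑ i ∈ Finset.range n, F (l i) (t i)
        ((n - 1, fun j => l (skip i j)), fun j => t (skip i j)) ∂T =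
        ∑ i ∈ Finset.range n, ∫⁻ t, F (l i) (t i)
        ((n - 1, fun j => l (skip i j)), fun j => t (skip i j)) ∂T := by
        intro l
        exact lintegral_finsetSum _ fun i _ => (hL2 n i).comp
          (f := fun t : ℕ → TreeData => (l, t)) (by fun_prop)
      simp only [e2]
      rw [lintegral_finsetSum]
      · simp only [K] at hone
        simp only [hone]
        simp
      · intro i _
        exact Measurable.lintegral_prod_right' (f := fun p : (ℕ → ℝ) × (ℕ → TreeData) =>
          F (p.1 i) (p.2 i) ((n - 1, fun j => p.1 (skip i j)), fun j => p.2 (skip i j)))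
          (hL2 n i)
    · exact (Measurable.lintegral_prod_right' hsum).aemeasurable
  -- Size-biasing replaces `n * H (n - 1)` by `r` times the mean of `H n`, and the factor `r` turns
  -- `costLaw` into `intensity`.
  rw [step1, lintegral_poissonMeasure_mul, intensity_eq_smul_costLaw hq hlam,
    lintegral_smul_measure, smul_eq_mul]
  congr 1
  have hH2 : ∀ n, H n = ∫⁻ z, ∫⁻ l, ∫⁻ t, F z.1 z.2 ((n, l), t) ∂T ∂K
      ∂((costLaw q lam).prod (treeLaw q lam)) := by
    intro n
    rw [hH, lintegral_prod]
    refine Measurable.aemeasurable ?_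
    refine Measurable.lintegral_prod_right' (f := fun z : (ℝ × TreeData) × (ℕ → ℝ) =>
      ∫⁻ t, F z.1.1 z.1.2 ((n, z.2), t) ∂T) ?_
    refine Measurable.lintegral_prod_right'
      (f := fun z : ((ℝ × TreeData) × (ℕ → ℝ)) × (ℕ → TreeData) =>
      F z.1.1.1 z.1.1.2 ((n, z.1.2), z.2)) ?_
    exact (hF3 n).comp (f := fun z : ((ℝ × TreeData) × (ℕ → ℝ)) × (ℕ → TreeData) =>
      (z.1.1.1, z.1.1.2, (z.1.2, z.2))) (by fun_prop)
  have mF : ∀ x ω', Measurable fun p => F x ω' p := fun x ω' =>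
    hF.comp (f := fun p : (ℕ × (ℕ → ℝ)) × (ℕ → TreeData) => (x, ω', p)) (by fun_prop)
  have hR : ∀ x ω', ∫⁻ ω, F x ω' (ω [], subtree ω) ∂(treeLaw q lam) =
      ∫⁻ n, ∫⁻ l, ∫⁻ t, F x ω' ((n, l), t) ∂T ∂K ∂(poissonMeasure r) := by
    intro x ω'
    rw [lintegral_treeLaw hq hlam (mF x ω'), lintegral_prod _ (mF x ω').aemeasurable, offspringLaw,
      lintegral_prod _ (Measurable.lintegral_prod_right' (mF x ω')).aemeasurable]
  simp only [hR, hH2]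
  rw [← lintegral_prod (f := fun z : ℝ × TreeData => ∫⁻ n, ∫⁻ l, ∫⁻ t, F z.1 z.2 ((n, l), t) ∂T ∂K
    ∂(poissonMeasure r)), lintegral_lintegral_swap]
  · refine Measurable.aemeasurable ?_
    have h5 : Measurable fun z : ((ℕ × (ℝ × TreeData)) × (ℕ → ℝ)) × (ℕ → TreeData) =>
        F z.1.1.2.1 z.1.1.2.2 ((z.1.1.1, z.1.2), z.2) :=
      hF.comp (f := fun z : ((ℕ × (ℝ × TreeData)) × (ℕ → ℝ)) × (ℕ → TreeData) =>
        (z.1.1.2.1, z.1.1.2.2, ((z.1.1.1, z.1.2), z.2))) (by fun_prop)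
    exact (Measurable.lintegral_prod_right' h5).lintegral_prod_right'
  · refine Measurable.aemeasurable ?_
    have h5 : Measurable fun z : (((ℝ × TreeData) × ℕ) × (ℕ → ℝ)) × (ℕ → TreeData) =>
        F z.1.1.1.1 z.1.1.1.2 ((z.1.1.2, z.1.2), z.2) :=
      hF.comp (f := fun z : (((ℝ × TreeData) × ℕ) × (ℕ → ℝ)) × (ℕ → TreeData) =>
        (z.1.1.1.1, z.1.1.1.2, ((z.1.1.2, z.1.2), z.2))) (by fun_prop)
    exact (Measurable.lintegral_prod_right' h5).lintegral_prod_right'.lintegral_prod_right'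

/-! ### Finite minima -/

/-- The minimum of `a` and `x 0, …, x (n - 1)`. -/
def minUpTo (a : ℝ) : ℕ → (ℕ → ℝ) → ℝ
  | 0, _ => a
  | n + 1, x => min (minUpTo a n x) (x n)

theorem le_minUpTo {a c : ℝ} {n : ℕ} {x : ℕ → ℝ} :
    c ≤ minUpTo a n x ↔ c ≤ a ∧ ∀ i < n, c ≤ x i := by
  induction n with
  | zero => simp [minUpTo]
  | succ n ih =>
    rw [minUpTo, le_min_iff, ih, and_assoc]
    refine and_congr_right fun _ => ⟨fun h i hi => ?_, fun h => ⟨fun i hi => h i (by omega), h n (by omega)⟩⟩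
    rcases Nat.lt_succ_iff_lt_or_eq.1 hi with h' | rfl
    exacts [h.1 i h', h.2]

theorem minUpTo_le {a : ℝ} {n : ℕ} {x : ℕ → ℝ} : minUpTo a n x ≤ a := (le_minUpTo.1 le_rfl).1

theorem minUpTo_le_apply {a : ℝ} {n : ℕ} {x : ℕ → ℝ} {i : ℕ} (hi : i < n) :
    minUpTo a n x ≤ x i := (le_minUpTo.1 le_rfl).2 i hi

theorem minUpTo_mono {a : ℝ} {n : ℕ} {x y : ℕ → ℝ} (h : ∀ i < n, x i ≤ y i) :
    minUpTo a n x ≤ minUpTo a n y :=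
  le_minUpTo.2 ⟨minUpTo_le, fun i hi => (minUpTo_le_apply hi).trans (h i hi)⟩

theorem minUpTo_mem (a : ℝ) (n : ℕ) (x : ℕ → ℝ) :
    minUpTo a n x ∈ insert a {y | ∃ i < n, y = x i} := by
  induction n with
  | zero => simp [minUpTo]
  | succ n ih =>
    rw [minUpTo]
    rcases min_choice (minUpTo a n x) (x n) with h | h <;> rw [h]
    · rcases ih with h | ⟨i, hi, h⟩
      exacts [Or.inl h, Or.inr ⟨i, by omega, h⟩]
    · exact Or.inr ⟨n, by omega, rfl⟩

theorem isLeast_iff_eq_minUpTo {a m : ℝ} {n : ℕ} {x : ℕ → ℝ} :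
    IsLeast (insert a {y | ∃ i < n, y = x i}) m ↔ m = minUpTo a n x := by
  have h : IsLeast (insert a {y | ∃ i < n, y = x i}) (minUpTo a n x) := by
    refine ⟨minUpTo_mem a n x, ?_⟩
    rintro y (rfl | ⟨i, hi, rfl⟩)
    exacts [minUpTo_le, minUpTo_le_apply hi]
  exact ⟨fun h' => h'.unique h, fun h' => h' ▸ h⟩

/-- Deleting one of the numbers. -/
theorem minUpTo_eq_min_skip {a : ℝ} {n i : ℕ} {x : ℕ → ℝ} (hi : i < n) :
    minUpTo a n x = min (minUpTo a (n - 1) fun j => x (skip i j)) (x i) := by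
  refine eq_of_forall_le_iff fun c => ?_
  rw [le_min_iff, le_minUpTo, le_minUpTo, and_assoc]
  refine and_congr_right fun _ => ⟨fun h => ⟨fun j hj => h _ ?_, h i hi⟩, fun h j hj => ?_⟩
  · simp only [skip]; split_ifs <;> omega
  · rcases lt_trichotomy j i with h' | rfl | h'
    · have := h.1 j (by omega)
      rwa [skip, if_pos h'] at this
    · exact h.2
    · have := h.1 (j - 1) (by omega)
      rwa [skip, if_neg (by omega), Nat.sub_add_cancel (by omega)] at this

theorem tendsto_minUpTo {a : ℝ} {n : ℕ} {x : ℕ → ℕ → ℝ} {y : ℕ → ℝ}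
    (h : ∀ i, Tendsto (fun k => x k i) atTop (𝓝 (y i))) :
    Tendsto (fun k => minUpTo a n (x k)) atTop (𝓝 (minUpTo a n y)) := by
  induction n with
  | zero => exact tendsto_const_nhds
  | succ n ih => exact ih.min (h n)

theorem measurable_minUpTo (a : ℝ) : Measurable fun p : ℕ × (ℕ → ℝ) => minUpTo a p.1 p.2 := by
  refine measurable_from_prod_countable_right fun n => ?_
  induction n with
  | zero => exact measurable_const
  | succ n ih => exact Measurable.min ih (measurable_pi_apply n)

/-! ### The extremal valuations as limits of finite games -/

/-- Lower (`false`) and upper (`true`) bounds for the value of the root that come from the first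
`k` levels. -/
def approxValue (lam : ℝ) : ℕ → Bool → TreeData → ℝ
  | 0, b, _ => bif b then lam / 2 else -(lam / 2)
  | k + 1, b, ω => minUpTo (lam / 2) (numChildren ω []) fun i =>
      |edgeCost ω [] i| - approxValue lam k (!b) (subtree ω i)

/-- The smallest (`false`) and the largest (`true`) possible value of the root, when costs are
replaced by their absolute values. -/
def value (lam : ℝ) (b : Bool) (ω : TreeData) : ℝ :=
  bif b then ⨅ k, approxValue lam k true ω else ⨆ k, approxValue lam k false ω

/-- Taking absolute values of the costs is what makes the lower bound hold for every `ω`; almost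
surely it changes nothing. -/
theorem approxValue_mem {lam : ℝ} (hlam : 0 ≤ lam) (k : ℕ) (b : Bool) (ω : TreeData) :
    approxValue lam k b ω ∈ Icc (-(lam / 2)) (lam / 2) := by
  induction k generalizing b ω with
  | zero => cases b <;> simp [approxValue] <;> linarith
  | succ k ih =>
    refine ⟨le_minUpTo.2 ⟨by linarith, fun i _ => ?_⟩, minUpTo_le⟩
    have := (ih (!b) (subtree ω i)).2
    have := abs_nonneg (edgeCost ω [] i)
    linarith

/-- The recursion reverses order and switches the type, so each monotonicity at one level gives the
other at the next. -/
theorem approxValue_step {lam : ℝ} (hlam : 0 ≤ lam) (k : ℕ) (ω : TreeData) :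
    approxValue lam k false ω ≤ approxValue lam (k + 1) false ω ∧
      approxValue lam (k + 1) true ω ≤ approxValue lam k true ω := by
  induction k generalizing ω with
  | zero => exact ⟨(approxValue_mem hlam 1 false ω).1, (approxValue_mem hlam 1 true ω).2⟩
  | succ k ih =>
    constructor
    · refine minUpTo_mono fun i _ => ?_
      have := (ih (subtree ω i)).2
      simp only [Bool.not_false]
      linarith
    · refine minUpTo_mono fun i _ => ?_
      have := (ih (subtree ω i)).1
      simp only [Bool.not_true]
      linarith

theorem tendsto_approxValue {lam : ℝ} (hlam : 0 ≤ lam) (b : Bool) (ω : TreeData) :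
    Tendsto (fun k => approxValue lam k b ω) atTop (𝓝 (value lam b ω)) := by
  cases b with
  | false =>
    refine tendsto_atTop_ciSup (monotone_nat_of_le_succ fun k => (approxValue_step hlam k ω).1)
      ⟨lam / 2, ?_⟩
    rintro _ ⟨k, rfl⟩
    exact (approxValue_mem hlam k _ ω).2
  | true =>
    refine tendsto_atTop_ciInf (antitone_nat_of_succ_le fun k => (approxValue_step hlam k ω).2)
      ⟨-(lam / 2), ?_⟩
    rintro _ ⟨k, rfl⟩
    exact (approxValue_mem hlam k _ ω).1

theorem value_mem {lam : ℝ} (hlam : 0 ≤ lam) (b : Bool) (ω : TreeData) :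
    value lam b ω ∈ Icc (-(lam / 2)) (lam / 2) :=
  isClosed_Icc.mem_of_tendsto (tendsto_approxValue hlam b ω)
    (Eventually.of_forall fun k => approxValue_mem hlam k b ω)

/-- Passage to the limit in the recursion of the finite games; a minimum over finitely many children
is continuous. -/
theorem value_eq {lam : ℝ} (hlam : 0 ≤ lam) (b : Bool) (ω : TreeData) :
    value lam b ω = minUpTo (lam / 2) (numChildren ω []) fun i =>
      |edgeCost ω [] i| - value lam (!b) (subtree ω i) := by
  refine tendsto_nhds_unique ((tendsto_add_atTop_iff_nat 1).2 (tendsto_approxValue hlam b ω)) ?_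
  exact tendsto_minUpTo fun i => tendsto_const_nhds.sub (tendsto_approxValue hlam (!b) _)

@[fun_prop]
theorem measurable_numChildren (u : List ℕ) : Measurable fun ω : TreeData => numChildren ω u :=
  measurable_fst.comp (measurable_pi_apply u)

@[fun_prop]
theorem measurable_edgeCost (u : List ℕ) (i : ℕ) : Measurable fun ω : TreeData => edgeCost ω u i :=
  (measurable_pi_apply i).comp (measurable_snd.comp (measurable_pi_apply u))

theorem measurable_approxValue (lam : ℝ) (k : ℕ) (b : Bool) :
    Measurable (approxValue lam k b) := by
  induction k generalizing b with
  | zero => exact measurable_const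
  | succ k ih =>
    have h := ih (!b)
    exact (measurable_minUpTo (lam / 2)).comp (f := fun ω : TreeData =>
      (numChildren ω [], fun i => |edgeCost ω [] i| - approxValue lam k (!b) (subtree ω i)))
      (by fun_prop)

@[fun_prop]
theorem measurable_value (lam : ℝ) (b : Bool) : Measurable (value lam b) := by
  cases b with
  | false => exact Measurable.iSup fun k => measurable_approxValue lam k false
  | true => exact Measurable.iInf fun k => measurable_approxValue lam k true

/-! ### Identification of the extremal valuation -/

/-- The subtree of `ω` rooted at `u`. -/
def descendants (ω : TreeData) (u : List ℕ) : TreeData := fun v => ω (v ++ u)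

theorem subtree_descendants (ω : TreeData) (u : List ℕ) (i : ℕ) :
    subtree (descendants ω u) i = descendants ω (i :: u) := by
  ext1 v; simp [subtree, descendants]

theorem descendants_append (ω : TreeData) (u : List ℕ) (i : ℕ) :
    descendants ω (u ++ [i]) = descendants (subtree ω i) u := by
  ext1 v; simp [subtree, descendants]

theorem descendants_nil (ω : TreeData) : descendants ω [] = ω := by
  ext1 v; simp [descendants]

@[fun_prop]
theorem measurable_descendants (u : List ℕ) : Measurable fun ω : TreeData => descendants ω u :=
  measurable_pi_iff.2 fun _ => measurable_pi_apply _

/-- The valuation that is minimal at vertices whose distance from the root is even and maximal at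
the other vertices. -/
def alternatingValue (lam : ℝ) (ω : TreeData) (u : List ℕ) : ℝ :=
  value lam u.length.bodd (descendants ω u)

theorem alternatingValue_eq {lam : ℝ} (hlam : 0 ≤ lam) (ω : TreeData) (u : List ℕ) :
    alternatingValue lam ω u = minUpTo (lam / 2) (numChildren ω u) fun i =>
      |edgeCost ω u i| - alternatingValue lam ω (i :: u) := by
  have h := value_eq hlam u.length.bodd (descendants ω u)
  simp only [subtree_descendants] at h
  simpa [alternatingValue, numChildren, edgeCost, descendants, Nat.bodd_succ] using h

theorem isValuation_iff {lam : ℝ} {ω : TreeData} {f : List ℕ → ℝ} :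
    IsValuation lam ω f ↔ ∀ u, IsVertex ω u → f u ∈ Icc (-(lam / 2)) (lam / 2) ∧
      f u = minUpTo (lam / 2) (numChildren ω u) fun i => edgeCost ω u i - f (i :: u) := by
  simp only [IsValuation, isLeast_iff_eq_minUpTo]

theorem isValuation_alternatingValue {lam : ℝ} (hlam : 0 ≤ lam) {ω : TreeData}
    (hω : ∀ u i, 0 ≤ edgeCost ω u i) : IsValuation lam ω (alternatingValue lam ω) := by
  refine isValuation_iff.2 fun u _ => ⟨value_mem hlam _ _, ?_⟩
  rw [alternatingValue_eq hlam]
  simp only [abs_of_nonneg (hω u _)]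

/-- Induction on the depth: bounds at the children become opposite bounds at the parent. -/
theorem IsValuation.mem_approxValue {lam : ℝ} {ω : TreeData}
    (hω : ∀ u i, 0 ≤ edgeCost ω u i) {f : List ℕ → ℝ} (hf : IsValuation lam ω f) (k : ℕ)
    (u : List ℕ) (hu : IsVertex ω u) :
    f u ∈ Icc (approxValue lam k false (descendants ω u))
      (approxValue lam k true (descendants ω u)) := by
  rw [isValuation_iff] at hf
  induction k generalizing u with
  | zero => exact (hf u hu).1
  | succ k ih =>
    have hc : ∀ i, |edgeCost (descendants ω u) [] i| = edgeCost ω u i := fun i =>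
      abs_of_nonneg (hω u i)
    have hn : numChildren (descendants ω u) [] = numChildren ω u := rfl
    rw [(hf u hu).2]
    simp only [approxValue, hc, hn, subtree_descendants]
    constructor <;> refine minUpTo_mono fun i hi => ?_
    · have := (ih (i :: u) ⟨hu, hi⟩).2
      simp only [Bool.not_false]
      linarith
    · have := (ih (i :: u) ⟨hu, hi⟩).1
      simp only [Bool.not_true]
      linarith

theorem bodd_eq_true_iff_odd {n : ℕ} : n.bodd = true ↔ Odd n := by
  rw [Nat.odd_iff, Nat.mod_two_of_bodd]
  cases n.bodd <;> simp

theorem bodd_eq_false_iff_even {n : ℕ} : n.bodd = false ↔ Even n := by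
  rw [Nat.even_iff, Nat.mod_two_of_bodd]
  cases n.bodd <;> simp

/-- The alternating values form one valuation, so the bounds of `IsValuation.mem_approxValue` are
attained in the limit at all vertices simultaneously. -/
theorem fA_eq_alternatingValue {lam : ℝ} (hlam : 0 ≤ lam) {ω : TreeData}
    (hω : ∀ u i, 0 ≤ edgeCost ω u i) {u : List ℕ} (hu : IsVertex ω u) :
    fA lam ω u = alternatingValue lam ω u := by
  rw [fA]
  split_ifs with h
  · refine IsLeast.csInf_eq ⟨⟨_, isValuation_alternatingValue hlam hω, rfl⟩, ?_⟩
    rintro _ ⟨f, hf, rfl⟩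
    rw [alternatingValue, bodd_eq_false_iff_even.2 h]
    exact le_of_tendsto' (tendsto_approxValue hlam false _) fun k =>
      (hf.mem_approxValue hω k u hu).1
  · refine IsGreatest.csSup_eq ⟨⟨_, isValuation_alternatingValue hlam hω, rfl⟩, ?_⟩
    rintro _ ⟨f, hf, rfl⟩
    rw [alternatingValue, bodd_eq_true_iff_odd.2 (Nat.not_even_iff_odd.1 h)]
    exact ge_of_tendsto' (tendsto_approxValue hlam true _) fun k =>
      (hf.mem_approxValue hω k u hu).2

theorem ae_costLaw_nonneg (q lam : ℝ) : ∀ᵐ x ∂(costLaw q lam), 0 ≤ x := by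
  have : ∀ᵐ x ∂(volume.restrict (Icc 0 lam) : Measure ℝ), 0 ≤ x :=
    (ae_restrict_mem measurableSet_Icc).mono fun x hx => hx.1
  have : ∀ᵐ x ∂(intensity q lam), 0 ≤ x := withDensity_absolutelyContinuous _ _ this
  exact Measure.ae_smul_measure this _

theorem ae_edgeCost_nonneg {q lam : ℝ} (hq : 0 < q) (hlam : 0 < lam) :
    ∀ᵐ ω ∂(treeLaw q lam), ∀ u i, 0 ≤ edgeCost ω u i := by
  have := offspringLaw_isProbabilityMeasure hq hlam
  have := costLaw_isProbabilityMeasure hq hlam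
  refine ae_all_iff.2 fun u => ae_all_iff.2 fun i => ?_
  have h1 : MeasurePreserving (fun ω : TreeData => ω u) (treeLaw q lam) (offspringLaw q lam) :=
    measurePreserving_eval_infinitePi (fun _ : List ℕ => offspringLaw q lam) u
  have h2 : MeasurePreserving (fun p : ℕ × (ℕ → ℝ) => p.2) (offspringLaw q lam)
      (Measure.infinitePi fun _ : ℕ => costLaw q lam) := measurePreserving_snd
  have h3 := measurePreserving_eval_infinitePi (fun _ : ℕ => costLaw q lam) i
  exact ((h3.comp h2).comp h1).quasiMeasurePreserving.ae (ae_costLaw_nonneg q lam)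

/-! ### Consequences of the Mecke formula -/

/-- The value that the root would have if its `i`-th child were deleted. -/
def valueWithout (lam : ℝ) (b : Bool) (ω : TreeData) (i : ℕ) : ℝ :=
  minUpTo (lam / 2) (numChildren ω [] - 1) fun j =>
    |edgeCost ω [] (skip i j)| - value lam (!b) (subtree ω (skip i j))

/-- The deviation of the `i`-th child of the root. -/
def gap (lam : ℝ) (b : Bool) (ω : TreeData) (i : ℕ) : ℝ :=
  |edgeCost ω [] i| - value lam b ω - value lam (!b) (subtree ω i)

@[fun_prop]
theorem measurable_gap (lam : ℝ) (b : Bool) (i : ℕ) : Measurable fun ω => gap lam b ω i := by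
  unfold gap; fun_prop

theorem value_eq_min {lam : ℝ} (hlam : 0 ≤ lam) (b : Bool) (ω : TreeData) {i : ℕ}
    (hi : i < numChildren ω []) :
    value lam b ω = min (valueWithout lam b ω i)
      (|edgeCost ω [] i| - value lam (!b) (subtree ω i)) := by
  rw [value_eq hlam, minUpTo_eq_min_skip hi]; rfl

theorem gap_nonneg {lam : ℝ} (hlam : 0 ≤ lam) (b : Bool) (ω : TreeData) {i : ℕ}
    (hi : i < numChildren ω []) : 0 ≤ gap lam b ω i := by
  have := value_eq_min hlam b ω hi ▸ min_le_right _ _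
  rw [gap]; linarith

/-- Expresses optimality of a child through quantities that the Mecke formula decouples. -/
theorem gap_eq_zero_iff {lam : ℝ} (hlam : 0 ≤ lam) (b : Bool) (ω : TreeData) {i : ℕ}
    (hi : i < numChildren ω []) : gap lam b ω i = 0 ↔
      |edgeCost ω [] i| - value lam (!b) (subtree ω i) ≤ valueWithout lam b ω i := by
  have h := value_eq_min hlam b ω hi
  rw [gap, ← min_eq_right_iff, ← h]
  constructor <;> intro h' <;> linarith

theorem ae_intensity_mem (q lam : ℝ) : ∀ᵐ x ∂(intensity q lam), x ∈ Icc 0 lam :=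
  withDensity_absolutelyContinuous _ _ (ae_restrict_mem measurableSet_Icc)

/-- Under the Mecke formula the tree without the distinguished child is again a tree with the
original law, so `valueWithout` becomes the value of an independent copy. -/
theorem mecke_value {q lam : ℝ} (hq : 0 < q) (hlam : 0 < lam) (b : Bool)
    {G : ℝ → TreeData → ℝ → ℝ≥0∞}
    (hG : Measurable fun p : ℝ × TreeData × ℝ => G p.1 p.2.1 p.2.2) :
    ∫⁻ ω, ∑ i ∈ Finset.range (numChildren ω []),
        G |edgeCost ω [] i| (subtree ω i) (valueWithout lam b ω i) ∂(treeLaw q lam) =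
      ∫⁻ x, ∫⁻ ω', ∫⁻ ω, G x ω' (value lam b ω) ∂(treeLaw q lam) ∂(treeLaw q lam)
        ∂(intensity q lam) := by
  have h := mecke hq hlam (F := fun x ω' p => G |x| ω' (minUpTo (lam / 2) p.1.1 fun j =>
    |p.1.2 j| - value lam (!b) (p.2 j))) ?_
  · simp only [valueWithout]
    rw [h]
    refine lintegral_congr_ae ?_
    filter_upwards [ae_intensity_mem q lam] with x hx
    rw [abs_of_nonneg hx.1]
    simp only [value_eq hlam.le b]
    rfl
  · have h1 : Measurable fun p : ℝ × TreeData × ((ℕ × (ℕ → ℝ)) × (ℕ → TreeData)) =>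
        minUpTo (lam / 2) p.2.2.1.1 fun j => |p.2.2.1.2 j| - value lam (!b) (p.2.2.2 j) :=
      (measurable_minUpTo (lam / 2)).comp
        (f := fun p : ℝ × TreeData × ((ℕ × (ℕ → ℝ)) × (ℕ → TreeData)) =>
        (p.2.2.1.1, fun j => |p.2.2.1.2 j| - value lam (!b) (p.2.2.2 j))) (by fun_prop)
    exact hG.comp (f := fun p : ℝ × TreeData × ((ℕ × (ℕ → ℝ)) × (ℕ → TreeData)) =>
      (|p.1|, p.2.1, minUpTo (lam / 2) p.2.2.1.1 fun j =>
        |p.2.2.1.2 j| - value lam (!b) (p.2.2.2 j))) (by fun_prop)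

/-- The probability that the value of the root is at least `z`. -/
def valueTail (q lam : ℝ) (b : Bool) (z : ℝ) : ℝ≥0∞ := treeLaw q lam {ω | z ≤ value lam b ω}

@[fun_prop]
theorem measurable_valueTail (q lam : ℝ) (b : Bool) : Measurable (valueTail q lam b) :=
  Antitone.measurable fun _ _ h => measure_mono fun _ h' => h.trans h'

/-- The operator that carries a function of the value of the root to a function of the value of
the child of deviation zero. -/
def childOp (q lam : ℝ) (b : Bool) (h : ℝ → ℝ≥0∞) (y : ℝ) : ℝ≥0∞ :=
  ∫⁻ x, h (x - y) * valueTail q lam b (x - y) ∂(intensity q lam)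

theorem sFinite_intensity {q lam : ℝ} : SFinite (intensity q lam) := by
  unfold intensity; infer_instance

theorem measurable_childOp (q lam : ℝ) (b : Bool) {h : ℝ → ℝ≥0∞} (hh : Measurable h) :
    Measurable (childOp q lam b h) := by
  have := sFinite_intensity (q := q) (lam := lam)
  unfold childOp
  exact Measurable.lintegral_prod_right' (f := fun p : ℝ × ℝ =>
    h (p.2 - p.1) * valueTail q lam b (p.2 - p.1)) (by fun_prop)

/-- Summation over the children of deviation zero. -/
theorem lintegral_sum_optimal {q lam : ℝ} (hq : 0 < q) (hlam : 0 < lam) (b : Bool)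
    {F : TreeData → ℝ≥0∞} (hF : Measurable F) {h : ℝ → ℝ≥0∞} (hh : Measurable h) :
    ∫⁻ ω, (∑ i ∈ Finset.range (numChildren ω []),
        if gap lam b ω i = 0 then F (subtree ω i) else 0) * h (value lam b ω) ∂(treeLaw q lam) =
      ∫⁻ ω, F ω * childOp q lam b h (value lam (!b) ω) ∂(treeLaw q lam) := by
  have := sFinite_intensity (q := q) (lam := lam)
  have := isProbabilityMeasure_treeLaw hq hlam
  have hG : Measurable fun p : ℝ × TreeData × ℝ =>
      if p.1 - value lam (!b) p.2.1 ≤ p.2.2 then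
        F p.2.1 * h (p.1 - value lam (!b) p.2.1) else 0 :=
    Measurable.ite (measurableSet_le (by fun_prop) (by fun_prop)) (by fun_prop) measurable_const
  have key := mecke_value hq hlam b (G := fun x ω' v =>
    if x - value lam (!b) ω' ≤ v then F ω' * h (x - value lam (!b) ω') else 0) hG
  -- An optimal child determines the value of the root, so `h` can be evaluated from the cost and
  -- the subtree of that child alone.
  have e1 : ∀ ω, (∑ i ∈ Finset.range (numChildren ω []),
        if gap lam b ω i = 0 then F (subtree ω i) else 0) * h (value lam b ω) =
      ∑ i ∈ Finset.range (numChildren ω []),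
        if |edgeCost ω [] i| - value lam (!b) (subtree ω i) ≤ valueWithout lam b ω i then
          F (subtree ω i) * h (|edgeCost ω [] i| - value lam (!b) (subtree ω i)) else 0 := by
    intro ω
    rw [Finset.sum_mul]
    refine Finset.sum_congr rfl fun i hi => ?_
    have hi' := Finset.mem_range.1 hi
    by_cases h0 : gap lam b ω i = 0
    · rw [if_pos h0, if_pos ((gap_eq_zero_iff hlam.le b ω hi').1 h0)]
      rw [gap] at h0
      congr 2
      linarith
    · rw [if_neg h0, if_neg (mt (gap_eq_zero_iff hlam.le b ω hi').2 h0), zero_mul]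
  simp only [e1]
  rw [key]
  -- The independent copy enters only through the threshold, which produces `valueTail`.
  have e2 : ∀ x ω', ∫⁻ ω, (if x - value lam (!b) ω' ≤ value lam b ω then
      F ω' * h (x - value lam (!b) ω') else 0) ∂(treeLaw q lam) =
      F ω' * (h (x - value lam (!b) ω') * valueTail q lam b (x - value lam (!b) ω')) := by
    intro x ω'
    have hs : MeasurableSet {ω | x - value lam (!b) ω' ≤ value lam b ω} :=
      measurableSet_le measurable_const (measurable_value lam b)
    have : ∀ ω, (if x - value lam (!b) ω' ≤ value lam b ω then
        F ω' * h (x - value lam (!b) ω') else 0) =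
        indicator {ω | x - value lam (!b) ω' ≤ value lam b ω}
          (fun _ => F ω' * h (x - value lam (!b) ω')) ω := fun ω => by
      simp [indicator]
    simp only [this]
    rw [lintegral_indicator_const hs, valueTail, mul_assoc]
  simp only [e2]
  rw [lintegral_lintegral_swap]
  · refine lintegral_congr fun ω' => ?_
    rw [lintegral_const_mul _ (by fun_prop), childOp]
  · exact Measurable.aemeasurable (by fun_prop)

/-- Summation over the children of positive deviation. -/
theorem lintegral_sum_discounted_le {q lam : ℝ} (hq : 0 < q) (hlam : 0 < lam) (b : Bool)
    {θ : ℝ} {η : ℝ≥0∞}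
    (hη : ∀ c, ∫⁻ x, (if c < x then ENNReal.ofReal (Real.exp (-θ * (x - c))) else 0)
      ∂(intensity q lam) ≤ η)
    {F : TreeData → ℝ≥0∞} (hF : Measurable F) {h : ℝ → ℝ≥0∞} (hh : Measurable h) :
    ∫⁻ ω, (∑ i ∈ Finset.range (numChildren ω []),
        if gap lam b ω i = 0 then 0 else
          ENNReal.ofReal (Real.exp (-θ * gap lam b ω i)) * F (subtree ω i)) *
        h (value lam b ω) ∂(treeLaw q lam) ≤
      η * (∫⁻ ω, F ω ∂(treeLaw q lam)) * ∫⁻ ω, h (value lam b ω) ∂(treeLaw q lam) := by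
  have := sFinite_intensity (q := q) (lam := lam)
  have := isProbabilityMeasure_treeLaw hq hlam
  have hG : Measurable fun p : ℝ × TreeData × ℝ =>
      F p.2.1 * (h p.2.2 * if p.2.2 + value lam (!b) p.2.1 < p.1 then
        ENNReal.ofReal (Real.exp (-θ * (p.1 - (p.2.2 + value lam (!b) p.2.1)))) else 0) := by
    refine Measurable.mul (by fun_prop) (Measurable.mul (by fun_prop) ?_)
    exact Measurable.ite (measurableSet_lt (by fun_prop) (by fun_prop)) (by fun_prop)
      measurable_const
  have key := mecke_value hq hlam b (G := fun x ω' v =>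
    F ω' * (h v * if v + value lam (!b) ω' < x then
      ENNReal.ofReal (Real.exp (-θ * (x - (v + value lam (!b) ω')))) else 0)) hG
  -- A child that is not optimal can be deleted without changing the value of the root, so `h` is
  -- evaluated at `valueWithout`, which the Mecke formula makes independent of the child.
  have e1 : ∀ ω, (∑ i ∈ Finset.range (numChildren ω []),
        if gap lam b ω i = 0 then 0 else
          ENNReal.ofReal (Real.exp (-θ * gap lam b ω i)) * F (subtree ω i)) *
        h (value lam b ω) =
      ∑ i ∈ Finset.range (numChildren ω []), F (subtree ω i) * (h (valueWithout lam b ω i) *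
        if valueWithout lam b ω i + value lam (!b) (subtree ω i) < |edgeCost ω [] i| then
          ENNReal.ofReal (Real.exp (-θ * (|edgeCost ω [] i| - (valueWithout lam b ω i +
            value lam (!b) (subtree ω i))))) else 0) := by
    intro ω
    rw [Finset.sum_mul]
    refine Finset.sum_congr rfl fun i hi => ?_
    have hi' := Finset.mem_range.1 hi
    by_cases h0 : gap lam b ω i = 0
    · have h1 := (gap_eq_zero_iff hlam.le b ω hi').1 h0
      rw [if_pos h0, if_neg (by linarith), zero_mul, mul_zero, mul_zero]
    · have h1 := mt (gap_eq_zero_iff hlam.le b ω hi').2 h0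
      have h2 : value lam b ω = valueWithout lam b ω i := by
        rw [value_eq_min hlam.le b ω hi', min_eq_left (by linarith)]
      rw [if_neg h0, if_pos (by linarith), ← h2, gap]
      rw [sub_sub]
      ring
  simp only [e1]
  rw [key, lintegral_lintegral_swap]
  -- The cost is integrated first, with both values fixed; `hη` is uniform in the threshold, so the
  -- other two factors separate.
  · calc _ = ∫⁻ ω', F ω' * ∫⁻ ω, h (value lam b ω) *
          ∫⁻ x, (if value lam b ω + value lam (!b) ω' < x then ENNReal.ofReal
            (Real.exp (-θ * (x - (value lam b ω + value lam (!b) ω')))) else 0) ∂(intensity q lam)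
            ∂(treeLaw q lam) ∂(treeLaw q lam) := by
          refine lintegral_congr fun ω' => ?_
          have m1 : Measurable fun p : ℝ × TreeData =>
              if value lam b p.2 + value lam (!b) ω' < p.1 then ENNReal.ofReal
              (Real.exp (-θ * (p.1 - (value lam b p.2 + value lam (!b) ω')))) else 0 :=
            Measurable.ite (measurableSet_lt (by fun_prop) (by fun_prop)) (by fun_prop)
              measurable_const
          have m2 : Measurable fun p : ℝ × TreeData => h (value lam b p.2) *
              if value lam b p.2 + value lam (!b) ω' < p.1 then ENNReal.ofReal
              (Real.exp (-θ * (p.1 - (value lam b p.2 + value lam (!b) ω')))) else 0 :=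
            Measurable.mul (by fun_prop) m1
          have m3 : ∀ x, Measurable fun ω => h (value lam b ω) *
              if value lam b ω + value lam (!b) ω' < x then ENNReal.ofReal
              (Real.exp (-θ * (x - (value lam b ω + value lam (!b) ω')))) else 0 := fun x =>
            m2.comp (f := fun ω : TreeData => (x, ω)) (by fun_prop)
          simp only [lintegral_const_mul _ (m3 _)]
          rw [lintegral_const_mul _ (Measurable.lintegral_prod_right' m2),
            lintegral_lintegral_swap m2.aemeasurable]
          congr 1
          refine lintegral_congr fun ω => ?_
          dsimp only
          rw [lintegral_const_mul]
          exact m1.comp (f := fun x : ℝ => (x, ω)) (by fun_prop)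
      _ ≤ ∫⁻ ω', F ω' * ∫⁻ ω, h (value lam b ω) * η ∂(treeLaw q lam) ∂(treeLaw q lam) := by
          gcongr with ω' ω
          exact hη _
      _ = _ := by
          rw [lintegral_mul_const _ hF, lintegral_mul_const _ (by fun_prop)]
          ring
  · refine Measurable.aemeasurable ?_
    exact Measurable.lintegral_prod_right' (f := fun p : (ℝ × TreeData) × TreeData =>
      F p.1.2 * (h (value lam b p.2) * if value lam b p.2 + value lam (!b) p.1.2 < p.1.1 then
      ENNReal.ofReal (Real.exp (-θ * (p.1.1 - (value lam b p.2 + value lam (!b) p.1.2)))) else 0))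
      (hG.comp (f := fun p : (ℝ × TreeData) × TreeData => (p.1.1, p.1.2, value lam b p.2))
        (by fun_prop))

instance nullSingletonClass_intensity (q lam : ℝ) : NullSingletonClass (intensity q lam) := by
  unfold intensity; infer_instance

/-- Almost surely no child achieves exactly the value that the root has without it. -/
theorem ae_ne_valueWithout {q lam : ℝ} (hq : 0 < q) (hlam : 0 < lam) (b : Bool) :
    ∀ᵐ ω ∂(treeLaw q lam), ∀ i < numChildren ω [],
      |edgeCost ω [] i| - value lam (!b) (subtree ω i) ≠ valueWithout lam b ω i := by
  have := sFinite_intensity (q := q) (lam := lam)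
  have := isProbabilityMeasure_treeLaw hq hlam
  have hG : Measurable fun p : ℝ × TreeData × ℝ =>
      if p.1 = p.2.2 + value lam (!b) p.2.1 then (1 : ℝ≥0∞) else 0 :=
    Measurable.ite (measurableSet_eq_fun (by fun_prop) (by fun_prop)) measurable_const
      measurable_const
  have key := mecke_value hq hlam b (G := fun x ω' v =>
    if x = v + value lam (!b) ω' then (1 : ℝ≥0∞) else 0) hG
  have m1 : Measurable fun p : (ℝ × TreeData) × TreeData =>
      if p.1.1 = value lam b p.2 + value lam (!b) p.1.2 then (1 : ℝ≥0∞) else 0 :=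
    hG.comp (f := fun p : (ℝ × TreeData) × TreeData => (p.1.1, p.1.2, value lam b p.2))
        (by fun_prop)
  rw [lintegral_lintegral_swap (Measurable.lintegral_prod_right' m1).aemeasurable] at key
  -- For fixed values a tie pins the cost to one point, which the intensity does not charge.
  have e0 : ∀ ω', ∫⁻ x, ∫⁻ ω, (if x = value lam b ω + value lam (!b) ω' then (1 : ℝ≥0∞) else 0)
      ∂(treeLaw q lam) ∂(intensity q lam) = 0 := by
    intro ω'
    rw [lintegral_lintegral_swap]
    · refine lintegral_eq_zero_of_ae_eq_zero (Eventually.of_forall fun ω => ?_)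
      refine lintegral_eq_zero_of_ae_eq_zero ?_
      have : ∀ᵐ x ∂(intensity q lam), x ≠ value lam b ω + value lam (!b) ω' := by
        rw [ae_iff]; simp
      filter_upwards [this] with x hx
      simp [hx]
    · exact (m1.comp (f := fun p : ℝ × TreeData => ((p.1, ω'), p.2)) (by fun_prop)).aemeasurable
  simp only [e0, lintegral_zero] at key
  have mvw : ∀ i, Measurable fun ω => valueWithout lam b ω i := fun i => by
    have hn : Measurable fun ω : TreeData => numChildren ω [] - 1 :=
      (measurable_from_top (f := fun n : ℕ => n - 1)).comp (measurable_numChildren [])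
    exact (measurable_minUpTo (lam / 2)).comp (f := fun ω : TreeData =>
      (numChildren ω [] - 1, fun j =>
        |edgeCost ω [] (skip i j)| - value lam (!b) (subtree ω (skip i j)))) (by fun_prop)
  have m2 : Measurable fun ω : TreeData => ∑ i ∈ Finset.range (numChildren ω []),
      if |edgeCost ω [] i| = valueWithout lam b ω i + value lam (!b) (subtree ω i) then
        (1 : ℝ≥0∞) else 0 := by
    have : Measurable fun p : ℕ × TreeData => ∑ i ∈ Finset.range p.1,
      if |edgeCost p.2 [] i| = valueWithout lam b p.2 i + value lam (!b) (subtree p.2 i) then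
        (1 : ℝ≥0∞) else 0 :=
      measurable_from_prod_countable_right fun n =>
        Finset.measurable_sum (Finset.range n) fun i _ => Measurable.ite
          (measurableSet_eq_fun (by fun_prop) (by fun_prop)) measurable_const measurable_const
    exact this.comp (f := fun ω : TreeData => (numChildren ω [], ω)) (by fun_prop)
  filter_upwards [(lintegral_eq_zero_iff m2).1 key] with ω hω i hi heq
  have := Finset.sum_eq_zero_iff.1 hω i (Finset.mem_range.2 hi)
  rw [if_pos (by linarith)] at this
  exact one_ne_zero this

/-- Almost surely at most one child has deviation zero, and none has when quitting is optimal. -/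
theorem ae_sum_optimal_le {q lam : ℝ} (hq : 0 < q) (hlam : 0 < lam) (b : Bool) :
    ∀ᵐ ω ∂(treeLaw q lam), (∑ i ∈ Finset.range (numChildren ω []),
      if gap lam b ω i = 0 then (1 : ℝ≥0∞) else 0) ≤ if value lam b ω < lam / 2 then 1 else 0 := by
  filter_upwards [ae_ne_valueWithout hq hlam b] with ω hω
  -- Without ties an optimal child strictly beats quitting and all its siblings.
  have hopt : ∀ i < numChildren ω [], gap lam b ω i = 0 →
      value lam b ω < valueWithout lam b ω i := by
    intro i hi h0
    have h1 := (gap_eq_zero_iff hlam.le b ω hi).1 h0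
    have h2 := lt_of_le_of_ne h1 (hω i hi)
    rw [gap] at h0
    linarith
  by_cases hex : ∃ i < numChildren ω [], gap lam b ω i = 0
  · obtain ⟨i, hi, h0⟩ := hex
    have h1 := hopt i hi h0
    rw [if_pos (h1.trans_le minUpTo_le), Finset.sum_eq_single i]
    · simp [h0]
    · intro j hj hji
      rw [if_neg]
      intro hj0
      have hj' := Finset.mem_range.1 hj
      have : valueWithout lam b ω i ≤ |edgeCost ω [] j| - value lam (!b) (subtree ω j) := by
        obtain ⟨k, hk, hs⟩ : ∃ k < numChildren ω [] - 1, skip i k = j := by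
          rcases lt_or_gt_of_ne hji with h | h
          · exact ⟨j, by omega, by rw [skip, if_pos h]⟩
          · exact ⟨j - 1, by omega, by rw [skip, if_neg (by omega)]; omega⟩
        subst hs
        exact minUpTo_le_apply hk
      rw [gap] at hj0
      linarith
    · intro hi'; exact absurd (Finset.mem_range.2 hi) hi'
  · push Not at hex
    rw [Finset.sum_eq_zero]
    · exact zero_le
    · intro i hi
      rw [if_neg (hex i (Finset.mem_range.1 hi))]

/-- The mean of `h (value)` on the event that quitting is not optimal. -/
def meanBelow (q lam : ℝ) (b : Bool) (h : ℝ → ℝ≥0∞) : ℝ≥0∞ :=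
  ∫⁻ ω in {ω | value lam b ω < lam / 2}, h (value lam b ω) ∂(treeLaw q lam)

theorem measurableSet_value_lt (lam : ℝ) (b : Bool) (c : ℝ) :
    MeasurableSet {ω | value lam b ω < c} :=
  measurableSet_lt (measurable_value lam b) measurable_const

/-- The case `F = 1` of `lintegral_sum_optimal`, combined with the bound on the number of optimal
children. -/
theorem lintegral_childOp_le {q lam : ℝ} (hq : 0 < q) (hlam : 0 < lam) (b : Bool)
    {h : ℝ → ℝ≥0∞} (hh : Measurable h) :
    ∫⁻ ω, childOp q lam b h (value lam (!b) ω) ∂(treeLaw q lam) ≤ meanBelow q lam b h := by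
  have := lintegral_sum_optimal hq hlam b (F := fun _ => 1) measurable_const hh
  simp only [one_mul] at this
  rw [← this, meanBelow, ← lintegral_indicator (measurableSet_value_lt lam b _)]
  refine lintegral_mono_ae ?_
  filter_upwards [ae_sum_optimal_le hq hlam b] with ω hω
  refine (mul_le_mul_left hω _).trans ?_
  simp only [indicator, mem_ofPred_eq]
  split_ifs <;> simp

/-! ### Singular kernels -/

/-- The singular function `|u| ^ (-ε)`. -/
def sing (ε u : ℝ) : ℝ≥0∞ := ENNReal.ofReal |u| ^ (-ε)

@[fun_prop]
theorem measurable_sing (ε : ℝ) : Measurable (sing ε) := by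
  unfold sing; fun_prop

theorem sing_neg (ε u : ℝ) : sing ε (-u) = sing ε u := by rw [sing, abs_neg, sing]

theorem sing_anti {ε u v : ℝ} (hε : 0 ≤ ε) (h : |u| ≤ |v|) : sing ε v ≤ sing ε u := by
  rw [sing, sing, ENNReal.rpow_neg, ENNReal.rpow_neg, ENNReal.inv_le_inv]
  exact ENNReal.rpow_le_rpow (ENNReal.ofReal_le_ofReal h) hε

theorem sing_half {ε : ℝ} (u : ℝ) : sing ε (u / 2) = ENNReal.ofReal (2 ^ ε) * sing ε u := by
  rw [sing, sing, abs_div, abs_two, div_eq_inv_mul, ENNReal.ofReal_mul (by norm_num),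
    ENNReal.mul_rpow_of_ne_top ENNReal.ofReal_ne_top ENNReal.ofReal_ne_top,
    ENNReal.ofReal_rpow_of_pos (by norm_num), Real.rpow_neg (by norm_num),
    Real.inv_rpow (by norm_num), inv_inv]

theorem sing_pow {ε u : ℝ} (n : ℕ) (hu : 0 < u) :
    sing ε u ^ n = ENNReal.ofReal (u ^ (-(ε * n))) := by
  rw [sing, abs_of_pos hu, ← ENNReal.rpow_natCast, ← ENNReal.rpow_mul,
    ENNReal.ofReal_rpow_of_pos hu]
  congr 2; ring

/-- Take `m` powers out of the smaller factor and replace what remains by powers of the larger one.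
-/
theorem pow_mul_pow_le {α β δ : ℝ≥0∞} (h : min α β ≤ δ) {m n : ℕ} (hmn : m ≤ n) :
    α ^ n * β ^ (m + 1) ≤ δ ^ m * (α ^ (n + 1) + β ^ (n + 1)) := by
  rcases le_total β α with h' | h'
  · rw [min_eq_right h'] at h
    calc α ^ n * β ^ (m + 1) = β ^ m * (α ^ n * β) := by ring
      _ ≤ δ ^ m * (α ^ n * α) := by gcongr
      _ ≤ _ := by rw [← pow_succ]; gcongr; exact le_self_add
  · rw [min_eq_left h'] at h
    obtain ⟨k, rfl⟩ := Nat.exists_eq_add_of_le hmn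
    calc α ^ (m + k) * β ^ (m + 1) = α ^ m * (α ^ k * β ^ (m + 1)) := by ring
      _ ≤ δ ^ m * (β ^ k * β ^ (m + 1)) := by gcongr
      _ ≤ _ := by
        rw [← pow_add, show k + (m + 1) = m + k + 1 by ring]; gcongr; exact le_add_self

/-- Every `y` has distance at least `|u - w| / 2` from one of `u` and `w`. The remaining powers have
exponent `n + 1`, integrable when `ε * (n + 1) < 1`. -/
theorem sing_mul_sing_le {ε : ℝ} (hε : 0 ≤ ε) {m n : ℕ} (hmn : m ≤ n) (y u w : ℝ) :
    sing ε (y - u) ^ n * sing ε (y - w) ^ (m + 1) ≤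
      sing ε ((u - w) / 2) ^ m * (sing ε (y - u) ^ (n + 1) + sing ε (y - w) ^ (n + 1)) := by
  refine pow_mul_pow_le ?_ hmn
  have : |(u - w) / 2| ≤ max |y - u| |y - w| := by
    rw [abs_div, abs_two]
    have h1 : |u - w| ≤ |y - w| + |y - u| := by
      have := abs_sub (y - w) (y - u)
      rwa [show y - w - (y - u) = u - w by ring] at this
    have h2 := le_max_left |y - u| |y - w|
    have h3 := le_max_right |y - u| |y - w|
    linarith
  rcases le_max_iff.1 this with h | h
  · exact (min_le_left _ _).trans (sing_anti hε h)
  · exact (min_le_right _ _).trans (sing_anti hε h)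

theorem lintegral_Icc_sing_pow_lt_top {ε : ℝ} {n : ℕ} (hε : ε * n < 1) (L : ℝ) :
    ∫⁻ v in Icc 0 L, sing ε v ^ n < ∞ := by
  rcases le_or_gt L 0 with hL | hL
  · have : (volume.restrict (Icc 0 L) : Measure ℝ) = 0 := by
      rw [Measure.restrict_eq_zero]
      simp [hL]
    rw [this]; simp
  -- The integrand is, up to a constant, the density of `intensity` with exponent `1 - ε * n`, whose
  -- total mass is known.
  have hq : 0 < 1 - ε * n := by linarith
  have h := intensity_univ hq hL
  rw [intensity, withDensity_apply _ MeasurableSet.univ, Measure.restrict_univ] at h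
  have e : ∫⁻ v in Icc 0 L, sing ε v ^ n = ∫⁻ v in Icc 0 L, (ENNReal.ofReal (1 - ε * n))⁻¹ *
      ENNReal.ofReal ((1 - ε * n) * v ^ (1 - ε * n - 1)) := by
    rw [← restrict_Ioc_eq_restrict_Icc]
    refine setLIntegral_congr_fun measurableSet_Ioc fun v hv => ?_
    rw [sing_pow n hv.1, ENNReal.ofReal_mul hq.le, ← mul_assoc, ENNReal.inv_mul_cancel, one_mul]
    · congr 2; ring
    · simpa using hq
    · exact ENNReal.ofReal_ne_top
  rw [e, lintegral_const_mul _ (by fun_prop), h]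
  exact ENNReal.mul_lt_top (by simpa using hq) ENNReal.ofReal_lt_top

theorem exists_lintegral_sing_pow_le {ε : ℝ} {n : ℕ} (hε : ε * n < 1) (a : ℝ) :
    ∃ C : ℝ≥0∞, C ≠ ∞ ∧ ∀ u ∈ Icc (-a) a, ∫⁻ y in Icc (-a) a, sing ε (y - u) ^ n ≤ C := by
  refine ⟨∫⁻ v in Icc 0 (2 * a), sing ε v ^ n + sing ε v ^ n, ?_, fun u hu => ?_⟩
  · rw [lintegral_add_left (by fun_prop)]
    exact (ENNReal.add_lt_top.2 ⟨lintegral_Icc_sing_pow_lt_top hε _,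
      lintegral_Icc_sing_pow_lt_top hε _⟩).ne
  · have h1 : ∫⁻ y in Icc u a, sing ε (y - u) ^ n ≤ ∫⁻ v in Icc 0 (2 * a), sing ε v ^ n := by
      rw [← lintegral_indicator measurableSet_Icc, ← lintegral_indicator measurableSet_Icc]
      conv_rhs => rw [← lintegral_sub_right_eq_self _ u]
      refine lintegral_mono fun y => ?_
      by_cases hy : y ∈ Icc u a
      · rw [indicator_of_mem hy, indicator_of_mem]
        exact ⟨by linarith [hy.1], by linarith [hy.2, hu.1]⟩
      · rw [indicator_of_notMem hy]; exact zero_le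
    have h2 : ∫⁻ y in Icc (-a) u, sing ε (y - u) ^ n ≤ ∫⁻ v in Icc 0 (2 * a), sing ε v ^ n := by
      rw [← lintegral_indicator measurableSet_Icc, ← lintegral_indicator measurableSet_Icc]
      conv_rhs => rw [← lintegral_sub_left_eq_self _ u]
      refine lintegral_mono fun y => ?_
      by_cases hy : y ∈ Icc (-a) u
      · rw [indicator_of_mem hy, indicator_of_mem, ← sing_neg, neg_sub]
        exact ⟨by linarith [hy.2], by linarith [hy.1, hu.2]⟩
      · rw [indicator_of_notMem hy]; exact zero_le
    rw [lintegral_add_left (by fun_prop), ← Icc_union_Icc_eq_Icc hu.1 hu.2]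
    exact (lintegral_union_le _ _ _).trans (by rw [add_comm]; gcongr)

/-- The symmetric kernel `|x - z| ^ (-ε m) + |x + z| ^ (-ε m)`. -/
def symKer (ε : ℝ) (m : ℕ) (x z : ℝ) : ℝ≥0∞ := sing ε (x - z) ^ m + sing ε (x + z) ^ m

theorem measurable_symKer (ε : ℝ) (m : ℕ) : Measurable fun p : ℝ × ℝ => symKer ε m p.1 p.2 := by
  unfold symKer; fun_prop

/-- Composition with a weakly singular kernel improves the singularity. -/
theorem exists_comp_symKer_le {ε : ℝ} (hε : 0 ≤ ε) {n : ℕ} (hn : ε * (n + 1) < 1) (a : ℝ) :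
    ∃ C : ℝ≥0∞, C ≠ ∞ ∧ ∀ m ≤ n, ∀ x ∈ Icc (-a) a, ∀ z ∈ Icc (-a) a,
      ∫⁻ y in Icc (-a) a, sing ε (x + y) ^ n * symKer ε (m + 1) y z ≤ C ^ (m + 1) * symKer ε m x z := by
  obtain ⟨C, hC, h⟩ := exists_lintegral_sing_pow_le (n := n + 1) (by push_cast; exact hn) a
  have key : ∀ m ≤ n, ∀ u ∈ Icc (-a) a, ∀ w ∈ Icc (-a) a,
      ∫⁻ y in Icc (-a) a, sing ε (y - u) ^ n * sing ε (y - w) ^ (m + 1) ≤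
        (max (2 * C) (ENNReal.ofReal (2 ^ ε))) ^ (m + 1) * sing ε (u - w) ^ m := by
    intro m hm u hu w hw
    calc _ ≤ ∫⁻ y in Icc (-a) a, sing ε ((u - w) / 2) ^ m *
          (sing ε (y - u) ^ (n + 1) + sing ε (y - w) ^ (n + 1)) :=
          lintegral_mono fun y => sing_mul_sing_le hε hm y u w
      _ = sing ε ((u - w) / 2) ^ m * ((∫⁻ y in Icc (-a) a, sing ε (y - u) ^ (n + 1)) +
          ∫⁻ y in Icc (-a) a, sing ε (y - w) ^ (n + 1)) := by
          rw [lintegral_const_mul _ (by fun_prop), lintegral_add_left (by fun_prop)]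
      _ ≤ sing ε ((u - w) / 2) ^ m * (C + C) := by gcongr; exacts [h u hu, h w hw]
      _ = ENNReal.ofReal (2 ^ ε) ^ m * (2 * C) * sing ε (u - w) ^ m := by
          rw [sing_half, mul_pow]; ring
      _ ≤ _ := by
          rw [pow_succ]
          gcongr
          · exact le_max_right _ _
          · exact le_max_left _ _
  refine ⟨max (2 * C) (ENNReal.ofReal (2 ^ ε)), ?_, fun m hm x hx z hz => ?_⟩
  · exact (max_lt (ENNReal.mul_lt_top (by simp) hC.lt_top) ENNReal.ofReal_lt_top).ne
  -- The factor in `x + y` is singular at `y = -x`: composing it with the singularity at `z` gives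
  -- one in `x + z`, and with that at `-z` one in `x - z`. The sum of both forms is therefore
  -- stable.
  · have hx' : -x ∈ Icc (-a) a := ⟨by linarith [hx.2], by linarith [hx.1]⟩
    have hz' : -z ∈ Icc (-a) a := ⟨by linarith [hz.2], by linarith [hz.1]⟩
    have h1 := key m hm (-x) hx' z hz
    have h2 := key m hm (-x) hx' (-z) hz'
    simp only [sub_neg_eq_add] at h1 h2
    rw [show -x - z = -(x + z) by ring, sing_neg] at h1
    rw [show -x + z = -(x - z) by ring, sing_neg] at h2
    calc _ = ∫⁻ y in Icc (-a) a, (sing ε (y + x) ^ n * sing ε (y - z) ^ (m + 1) +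
          sing ε (y + x) ^ n * sing ε (y + z) ^ (m + 1)) := by
          refine lintegral_congr fun y => ?_
          rw [symKer, mul_add, add_comm x y]
      _ ≤ _ := by
          rw [lintegral_add_left (by fun_prop), symKer, mul_add, add_comm (_ * sing ε (x - z) ^ m)]
          gcongr

/-! ### The game ends with a probability that is bounded from below -/

theorem valueTail_eq_zero {q lam : ℝ} (hlam : 0 ≤ lam) (b : Bool) {z : ℝ} (hz : lam / 2 < z) :
    valueTail q lam b z = 0 := by
  rw [valueTail]
  convert measure_empty (μ := treeLaw q lam)
  ext ω
  simp only [mem_ofPred_eq, mem_empty_iff_false, iff_false, not_le]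
  exact (value_mem hlam b ω).2.trans_lt hz

/-! ### Upper and lower bounds for the kernel of `childOp`. -/

theorem lintegral_intensity {q lam : ℝ} (g : ℝ → ℝ≥0∞) (hg : Measurable g) :
    ∫⁻ x, g x ∂(intensity q lam) =
      ∫⁻ x in Icc 0 lam, ENNReal.ofReal (q * x ^ (q - 1)) * g x := by
  rw [intensity, lintegral_withDensity_eq_lintegral_mul _ (by fun_prop) hg]
  rfl

theorem intensity_density_le {q lam ε : ℝ} {n : ℕ} (hq : 0 < q) (hq1 : q < 1) (hε : 1 - q ≤ ε * n) {x : ℝ}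
    (hx : x ∈ Icc 0 lam) : ENNReal.ofReal (q * x ^ (q - 1)) ≤
      ENNReal.ofReal (q * lam ^ (q - 1 + ε * n)) * sing ε x ^ n := by
  -- At `0` the real power with nonzero exponent `q - 1` is `0` by convention, so there is nothing
  -- to prove there.
  rcases hx.1.eq_or_lt with rfl | h0
  · rw [Real.zero_rpow (sub_ne_zero.2 hq1.ne)]; simp
  · rw [sing_pow n h0, ← ENNReal.ofReal_mul (by have := hx.1.trans hx.2; positivity)]
    refine ENNReal.ofReal_le_ofReal ?_
    rw [mul_assoc]
    refine mul_le_mul_of_nonneg_left ?_ hq.le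
    calc x ^ (q - 1) = x ^ (q - 1 + ε * n) * x ^ (-(ε * n)) := by
          rw [← Real.rpow_add h0]; congr 1; ring
      _ ≤ _ := by
          gcongr
          · linarith
          · exact hx.2

/-- Substitute for the cost the sum `z + x` of the two values; `valueTail` vanishes above `lam / 2`
and nonnegativity of the cost bounds `z` from below. -/
theorem childOp_le {q lam ε : ℝ} {n : ℕ} (hq : 0 < q) (hq1 : q < 1) (hlam : 0 < lam) (hε : 1 - q ≤ ε * n)
    (b : Bool) {h : ℝ → ℝ≥0∞} (hh : Measurable h) {x : ℝ} (hx : x ∈ Icc (-(lam / 2)) (lam / 2)) :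
    childOp q lam b h x ≤ ENNReal.ofReal (q * lam ^ (q - 1 + ε * n)) *
      ∫⁻ z in Icc (-(lam / 2)) (lam / 2), sing ε (x + z) ^ n * (h z * valueTail q lam b z) := by
  rw [childOp, lintegral_intensity _ (by fun_prop), ← lintegral_const_mul _ (by fun_prop),
    ← lintegral_indicator measurableSet_Icc, ← lintegral_indicator measurableSet_Icc]
  conv_lhs => rw [← lintegral_add_right_eq_self _ x]
  refine lintegral_mono fun z => ?_
  by_cases hz : z + x ∈ Icc 0 lam
  · rw [indicator_of_mem hz, add_sub_cancel_right]
    by_cases hz' : z ≤ lam / 2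
    · have hz'' : z ∈ Icc (-(lam / 2)) (lam / 2) := ⟨by linarith [hz.1, hx.2], hz'⟩
      rw [indicator_of_mem hz'', add_comm x z]
      exact (mul_le_mul_left (intensity_density_le hq hq1 hε hz) _).trans
        (mul_assoc _ _ _).le
    · rw [valueTail_eq_zero hlam.le b (not_le.1 hz')]; simp
  · rw [indicator_of_notMem hz]; exact zero_le

/-- At a child of value `lam / 2` every root value above `-(lam / 2)` corresponds to a cost in `(0,
lam]`, where the density is at least its value at `lam`. -/
theorem le_childOp {q lam : ℝ} (hq : 0 < q) (hq1 : q ≤ 1) (b : Bool)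
    {h : ℝ → ℝ≥0∞} (hh : Measurable h) :
    ENNReal.ofReal (q * lam ^ (q - 1)) *
      ∫⁻ z in Icc (-(lam / 2)) (lam / 2), h z * valueTail q lam b z ≤
      childOp q lam b h (lam / 2) := by
  rw [childOp, lintegral_intensity _ (by fun_prop), ← lintegral_const_mul _ (by fun_prop),
    ← restrict_Ioc_eq_restrict_Icc, ← restrict_Ioc_eq_restrict_Icc,
    ← lintegral_indicator measurableSet_Ioc, ← lintegral_indicator measurableSet_Ioc]
  conv_rhs => rw [← lintegral_add_right_eq_self _ (lam / 2)]
  refine lintegral_mono fun z => ?_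
  by_cases hz : z ∈ Ioc (-(lam / 2)) (lam / 2)
  · have hz' : z + lam / 2 ∈ Ioc 0 lam := ⟨by linarith [hz.1], by linarith [hz.2]⟩
    rw [indicator_of_mem hz, indicator_of_mem hz', add_sub_cancel_right]
    refine mul_le_mul_left (ENNReal.ofReal_le_ofReal (mul_le_mul_of_nonneg_left ?_ hq.le)) _
    exact Real.rpow_le_rpow_of_nonpos hz'.1 hz'.2 (by linarith)
  · rw [indicator_of_notMem hz]; exact zero_le

/-- Iteration of `childOp`, starting from functions of the minimal value. -/
def iterOp (q lam : ℝ) (h : ℝ → ℝ≥0∞) : ℕ → ℝ → ℝ≥0∞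
  | 0 => h
  | n + 1 => childOp q lam n.bodd (iterOp q lam h n)

theorem measurable_iterOp (q lam : ℝ) {h : ℝ → ℝ≥0∞} (hh : Measurable h) (n : ℕ) :
    Measurable (iterOp q lam h n) := by
  induction n with
  | zero => exact hh
  | succ n ih => exact measurable_childOp q lam _ ih

theorem meanBelow_le (q lam : ℝ) (b : Bool) (h : ℝ → ℝ≥0∞) :
    meanBelow q lam b h ≤ ∫⁻ ω, h (value lam b ω) ∂(treeLaw q lam) := setLIntegral_le_lintegral _ _

theorem lintegral_iterOp_succ_le {q lam : ℝ} (hq : 0 < q) (hlam : 0 < lam) {h : ℝ → ℝ≥0∞}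
    (hh : Measurable h) (n : ℕ) :
    ∫⁻ ω, iterOp q lam h (n + 1) (value lam (n + 1).bodd ω) ∂(treeLaw q lam) ≤
      meanBelow q lam n.bodd (iterOp q lam h n) := by
  rw [Nat.bodd_succ]
  exact lintegral_childOp_le hq hlam n.bodd (measurable_iterOp q lam hh n)

theorem antitone_lintegral_iterOp {q lam : ℝ} (hq : 0 < q) (hlam : 0 < lam) {h : ℝ → ℝ≥0∞}
    (hh : Measurable h) :
    Antitone fun n : ℕ => ∫⁻ ω, iterOp q lam h n (value lam n.bodd ω) ∂(treeLaw q lam) :=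
  antitone_nat_of_succ_le fun n =>
    (lintegral_iterOp_succ_le hq hlam hh n).trans (meanBelow_le _ _ _ _)

theorem valueTail_le_one {q lam : ℝ} (hq : 0 < q) (hlam : 0 < lam) (b : Bool) (z : ℝ) :
    valueTail q lam b z ≤ 1 := by
  have := isProbabilityMeasure_treeLaw hq hlam
  exact prob_le_one

/-- Each further application of `childOp` lowers the exponent of the singularity by `ε`; for `j = n`
the kernel is bounded. Tails at intermediate values are dropped, while the one at the starting value
is kept to match `le_childOp`. -/
theorem exists_iterOp_le {q lam ε : ℝ} {n : ℕ} (hq : 0 < q) (hq1 : q < 1) (hlam : 0 < lam) (hε0 : 0 ≤ ε)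
    (hε : 1 - q ≤ ε * n) (hn : ε * (n + 1) < 1) (j : ℕ) (hj : j ≤ n) :
    ∃ C : ℝ≥0∞, C ≠ ∞ ∧ ∀ h : ℝ → ℝ≥0∞, Measurable h → ∀ x ∈ Icc (-(lam / 2)) (lam / 2),
      iterOp q lam h (j + 1) x ≤ C * ∫⁻ z in Icc (-(lam / 2)) (lam / 2),
        symKer ε (n - j) x z * (h z * valueTail q lam false z) := by
  have hC1 : ENNReal.ofReal (q * lam ^ (q - 1 + ε * n)) ≠ ∞ := ENNReal.ofReal_ne_top
  set C1 := ENNReal.ofReal (q * lam ^ (q - 1 + ε * n))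
  induction j with
  | zero =>
    refine ⟨C1, hC1, fun h hh x hx => ?_⟩
    refine (childOp_le hq hq1 hlam hε false hh hx).trans ?_
    gcongr with z
    exact le_add_self
  | succ j ih =>
    obtain ⟨C2, hC2, h2⟩ := ih (by omega)
    obtain ⟨C3, hC3, h3⟩ := exists_comp_symKer_le hε0 hn (lam / 2)
    refine ⟨C1 * C2 * C3 ^ (n - (j + 1) + 1), ENNReal.mul_ne_top (ENNReal.mul_ne_top hC1 hC2)
      (ENNReal.pow_ne_top hC3), fun h hh x hx => ?_⟩
    have hnj : n - j = n - (j + 1) + 1 := by omega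
    rw [hnj] at h2
    set m := n - (j + 1)
    set I := Icc (-(lam / 2)) (lam / 2)
    set g := fun z => h z * valueTail q lam false z with hg
    have mg : Measurable g := by fun_prop
    have mk := measurable_symKer ε (m + 1)
    calc iterOp q lam h (j + 1 + 1) x ≤ C1 * ∫⁻ y in I, sing ε (x + y) ^ n *
          (iterOp q lam h (j + 1) y * valueTail q lam (j + 1).bodd y) :=
          childOp_le hq hq1 hlam hε _ (measurable_iterOp q lam hh _) hx
      _ ≤ C1 * ∫⁻ y in I, sing ε (x + y) ^ n *
          ((C2 * ∫⁻ z in I, symKer ε (m + 1) y z * g z) * 1) := by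
          gcongr C1 * ?_
          refine setLIntegral_mono' measurableSet_Icc fun y hy => ?_
          gcongr
          · exact h2 h hh y hy
          · exact valueTail_le_one hq hlam _ y
      _ = C1 * (C2 * ∫⁻ y in I, ∫⁻ z in I, sing ε (x + y) ^ n * (symKer ε (m + 1) y z * g z)) := by
          rw [← lintegral_const_mul C2]
          · congr 1
            refine lintegral_congr fun y => ?_
            rw [lintegral_const_mul]
            · ring
            · exact (mk.comp (f := fun z : ℝ => (y, z)) (by fun_prop)).mul mg
          · exact Measurable.lintegral_prod_right' (f := fun p : ℝ × ℝ =>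
              sing ε (x + p.1) ^ n * (symKer ε (m + 1) p.1 p.2 * g p.2)) (by fun_prop)
      _ = C1 * (C2 * ∫⁻ z in I, (∫⁻ y in I, sing ε (x + y) ^ n * symKer ε (m + 1) y z) * g z) := by
          rw [lintegral_lintegral_swap]
          · congr 2
            refine lintegral_congr fun z => ?_
            rw [← lintegral_mul_const]
            · simp only [mul_assoc]
            · exact Measurable.mul (by fun_prop) (mk.comp (f := fun y : ℝ => (y, z)) (by fun_prop))
          · exact Measurable.aemeasurable (f := fun p : ℝ × ℝ =>
              sing ε (x + p.1) ^ n * (symKer ε (m + 1) p.1 p.2 * g p.2)) (by fun_prop)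
      _ ≤ C1 * (C2 * ∫⁻ z in I, (C3 ^ (m + 1) * symKer ε m x z) * g z) := by
          gcongr C1 * (C2 * ?_)
          refine setLIntegral_mono' measurableSet_Icc fun z hz => ?_
          gcongr
          exact h3 m (by omega) x hx z hz
      _ = _ := by
          have mk' := (measurable_symKer ε m).comp (f := fun z : ℝ => (x, z)) (by fun_prop)
          have mk'' : Measurable fun z => symKer ε m x z * g z := Measurable.mul mk' mg
          simp only [mul_assoc (C3 ^ (m + 1))]
          rw [lintegral_const_mul _ mk'']
          ring

/-- With positive probability the root has no children. -/
theorem treeLaw_value_eq_pos {q lam : ℝ} (hq : 0 < q) (hlam : 0 < lam) (b : Bool) :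
    treeLaw q lam {ω | value lam b ω = lam / 2} ≠ 0 := by
  have := offspringLaw_isProbabilityMeasure hq hlam
  have := costLaw_isProbabilityMeasure hq hlam
  have h1 : MeasurePreserving (fun ω : TreeData => ω []) (treeLaw q lam) (offspringLaw q lam) :=
    measurePreserving_eval_infinitePi (fun _ : List ℕ => offspringLaw q lam) []
  have h2 : MeasurePreserving (fun p : ℕ × (ℕ → ℝ) => p.1) (offspringLaw q lam)
      (poissonMeasure (intensity q lam univ).toNNReal) := measurePreserving_fst
  have h3 := (h2.comp h1).measure_preimage (s := {0}) (MeasurableSet.nullMeasurableSet (by simp))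
  rw [poissonMeasure_singleton] at h3
  have h4 : treeLaw q lam ((fun p : ℕ × (ℕ → ℝ) => p.1) ∘ (fun ω : TreeData => ω []) ⁻¹' {0}) ≤
      treeLaw q lam {ω | value lam b ω = lam / 2} := by
    refine measure_mono fun ω hω => ?_
    have : numChildren ω [] = 0 := hω
    rw [mem_ofPred_eq, value_eq hlam.le, this]
    rfl
  rw [h3] at h4
  refine (lt_of_lt_of_le ?_ h4).ne'
  rw [ENNReal.ofReal_pos]
  simp [Real.exp_pos]

/-- Contraction: the probability that a path without deviations survives for a certain number of
steps is bounded away from one, uniformly in the value of the root. -/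
theorem exists_iterOp_contraction {q lam : ℝ} (hq : 0 < q) (hq1 : q < 1) (hlam : 0 < lam) :
    ∃ (r : ℕ) (ρ : ℝ≥0∞), 0 < r ∧ ρ < 1 ∧ ∀ h : ℝ → ℝ≥0∞, Measurable h →
      ∫⁻ ω, iterOp q lam h (2 * r) (value lam false ω) ∂(treeLaw q lam) ≤
        ρ * meanBelow q lam false h := by
  have := isProbabilityMeasure_treeLaw hq hlam
  -- With `ε = 1 / (n + 2)` this makes `ε * n ≥ 1 - q`, so the density is dominated, while `ε * (n +
  -- 1) < 1` keeps the compositions integrable.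
  obtain ⟨n, hn⟩ := exists_nat_gt (2 / q)
  have hn0 : (0 : ℝ) < n := lt_trans (by positivity) hn
  have hqn : 2 < q * n := by rwa [div_lt_iff₀' hq] at hn
  have e1 : (1 : ℝ) / (n + 2) * n = 1 - 2 / (n + 2) := by field_simp; ring
  obtain ⟨C, hC, hCh⟩ := exists_iterOp_le (ε := 1 / (n + 2)) (n := n) hq hq1 hlam (by positivity)
    (by
      rw [e1]
      have : 2 / ((n : ℝ) + 2) ≤ q := by
        rw [div_le_iff₀ (by positivity)]; nlinarith
      linarith)
    (by rw [one_div, inv_mul_lt_iff₀ (by positivity)]; linarith) n le_rfl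
  set p := treeLaw q lam {ω | value lam true ω = lam / 2} with hp
  have hp0 : p ≠ 0 := treeLaw_value_eq_pos hq hlam true
  have hp1 : p ≠ ∞ := measure_ne_top _ _
  set c := ENNReal.ofReal (q * lam ^ (q - 1)) with hc
  have hc0 : c ≠ 0 := by
    rw [hc, ne_eq, ENNReal.ofReal_eq_zero, not_le]
    positivity
  have hc1 : c ≠ ∞ := ENNReal.ofReal_ne_top
  set D := C * 2 / (p * c) with hD
  have hDtop : D ≠ ∞ := ENNReal.div_ne_top (ENNReal.mul_ne_top hC (by simp))
    (mul_ne_zero hp0 hc0)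
  -- Smoothing takes `n + 1` steps; the number is doubled so that the type of the vertex is again
  -- that of the root.
  refine ⟨n + 1, D / (1 + D), n.succ_pos, ?_, fun h hh => ?_⟩
  · refine ENNReal.div_lt_of_lt_mul ?_
    rw [one_mul, add_comm]
    exact ENNReal.lt_add_right hDtop one_ne_zero
  have hanti := antitone_lintegral_iterOp hq hlam hh
  set S := ∫⁻ ω, iterOp q lam h (2 * (n + 1)) (value lam false ω) ∂(treeLaw q lam) with hS
  have hbodd : (2 * (n + 1)).bodd = false := bodd_eq_false_iff_even.2 (even_two_mul _)
  have hS' : S = ∫⁻ ω, iterOp q lam h (2 * (n + 1)) (value lam (2 * (n + 1)).bodd ω)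
      ∂(treeLaw q lam) := by rw [hbodd]
  set I := ∫⁻ z in Icc (-(lam / 2)) (lam / 2), h z * valueTail q lam false z with hI
  have b1 : S ≤ C * 2 * I := by
    rw [hS']
    refine (hanti (show n + 1 ≤ 2 * (n + 1) by omega)).trans ?_
    calc _ ≤ ∫⁻ ω, C * 2 * I ∂(treeLaw q lam) := by
          refine lintegral_mono fun ω => ?_
          refine (hCh h hh _ (value_mem hlam.le _ ω)).trans (le_of_eq ?_)
          simp only [Nat.sub_self, symKer, pow_zero, one_add_one_eq_two]
          rw [lintegral_const_mul _ (by fun_prop), mul_assoc]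
      _ = _ := by simp
  set d := p * childOp q lam false h (lam / 2) with hd
  have b2 : S ≤ D * d := by
    calc S ≤ C * 2 * I := b1
      _ = D * (p * (c * I)) := by
          rw [hD, ← mul_assoc p, ← mul_assoc, ENNReal.div_mul_cancel (mul_ne_zero hp0 hc0)
            (ENNReal.mul_ne_top hp1 hc1)]
      _ ≤ D * d := by rw [hd]; gcongr; exact le_childOp hq hq1.le false hh
  -- After one step, split according to whether quitting is optimal at the child: the mass `d` dies
  -- there, and what survives dominates `S`.
  have b3 : S + d ≤ meanBelow q lam false h := by
    have e0 := lintegral_childOp_le hq hlam false hh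
    refine le_trans ?_ e0
    have mE := measurableSet_value_lt lam true (lam / 2)
    rw [← lintegral_add_compl _ mE]
    gcongr
    · rw [hS']
      refine (hanti (show 2 ≤ 2 * (n + 1) by omega)).trans ?_
      exact lintegral_iterOp_succ_le hq hlam hh 1
    · have : {ω | value lam true ω < lam / 2}ᶜ = {ω | value lam true ω = lam / 2} := by
        ext ω
        simp only [mem_compl_iff, mem_ofPred_eq, not_lt]
        exact ⟨fun h' => le_antisymm (value_mem hlam.le true ω).2 h', fun h' => h'.ge⟩
      rw [hd, hp, ← this, mul_comm, ← setLIntegral_const]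
      refine setLIntegral_mono' mE.compl fun ω hω => ?_
      rw [this] at hω
      rw [← hω]
      exact le_rfl
  rw [mul_comm, ← mul_div_assoc, ENNReal.le_div_iff_mul_le (Or.inl (by simp))
    (Or.inl (by simpa using hDtop))]
  calc S * (1 + D) = S + D * S := by ring
    _ ≤ D * d + D * S := by gcongr
    _ = (S + d) * D := by ring
    _ ≤ _ := by gcongr

/-! ### The discounted number of paths -/

/-- Costs below `d` have total intensity `d ^ q = η / 2`. Above `d` the density is at most `M`, so
the exponential contributes at most `M / θ = η / 2`. -/
theorem exists_discount {q : ℝ} (hq : 0 < q) (hq1 : q < 1) (lam : ℝ) {η : ℝ} (hη : 0 < η) :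
    ∃ θ : ℝ, 0 < θ ∧ ∀ c, ∫⁻ x, (if c < x then ENNReal.ofReal (Real.exp (-θ * (x - c))) else 0)
      ∂(intensity q lam) ≤ ENNReal.ofReal η := by
  set d := (η / 2) ^ (1 / q) with hd
  have hd0 : 0 < d := by positivity
  have hdq : d ^ q = η / 2 := by
    rw [hd, ← Real.rpow_mul (by positivity), one_div, inv_mul_cancel₀ hq.ne', Real.rpow_one]
  set M := q * d ^ (q - 1) with hM
  have hM0 : 0 < M := by positivity
  set θ := M / (η / 2) with hθ
  have hθ0 : 0 < θ := by positivity
  refine ⟨θ, hθ0, fun c => ?_⟩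
  have mφ : Measurable fun x : ℝ =>
      if c < x then ENNReal.ofReal (Real.exp (-θ * (x - c))) else 0 :=
    Measurable.ite (measurableSet_lt (by fun_prop) (by fun_prop)) (by fun_prop) measurable_const
  have mpdf : Measurable (exponentialPDF θ) := by
    unfold exponentialPDF
    exact (measurable_exponentialPDFReal θ).ennreal_ofReal
  rw [lintegral_intensity _ mφ, ← restrict_Ioc_eq_restrict_Icc]
  calc _ ≤ ∫⁻ x, ((Icc 0 d).indicator (fun x => ENNReal.ofReal (q * x ^ (q - 1))) x +
        ENNReal.ofReal (M / θ) * exponentialPDF θ (x - c)) := by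
        rw [← lintegral_indicator measurableSet_Ioc]
        refine lintegral_mono fun x => ?_
        by_cases hx : x ∈ Ioc 0 lam
        swap
        · rw [indicator_of_notMem hx]; exact zero_le
        rw [indicator_of_mem hx]
        by_cases hc : c < x
        swap
        · rw [if_neg hc]; simp
        rw [if_pos hc]
        by_cases hxd : x ≤ d
        · refine le_trans ?_ le_self_add
          rw [indicator_of_mem (show x ∈ Icc 0 d from ⟨hx.1.le, hxd⟩)]
          refine mul_le_of_le_one_right zero_le ?_
          rw [ENNReal.ofReal_le_one, Real.exp_le_one_iff]
          nlinarith
        · refine le_trans ?_ le_add_self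
          rw [exponentialPDF_eq, if_pos (by linarith),
            ← ENNReal.ofReal_mul (mul_nonneg hq.le (Real.rpow_nonneg hx.1.le _)),
            ← ENNReal.ofReal_mul (by positivity)]
          refine ENNReal.ofReal_le_ofReal ?_
          rw [← mul_assoc, div_mul_cancel₀ _ hθ0.ne', neg_mul]
          refine mul_le_mul_of_nonneg_right ?_ (Real.exp_pos _).le
          refine mul_le_mul_of_nonneg_left ?_ hq.le
          exact Real.rpow_le_rpow_of_nonpos hd0 (not_le.1 hxd).le (by linarith)
    _ = ENNReal.ofReal (η / 2) + ENNReal.ofReal (M / θ) * 1 := by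
        have h1 := intensity_univ hq hd0
        rw [intensity, withDensity_apply _ MeasurableSet.univ, Measure.restrict_univ, hdq] at h1
        rw [lintegral_add_right _ (by fun_prop), lintegral_indicator measurableSet_Icc, h1,
          lintegral_const_mul _ (by fun_prop), lintegral_sub_right_eq_self (exponentialPDF θ) c,
          lintegral_exponentialPDF_eq_one hθ0]
    _ = ENNReal.ofReal η := by
        rw [mul_one, ← ENNReal.ofReal_add (by positivity) (by positivity)]
        congr 1
        rw [hθ]
        field_simp
        ring

/-- The weight of a step to a child. -/
def stepWeight (θ : ℝ) (b : Bool) (d : ℝ) : ℝ≥0∞ :=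
  bif b then ENNReal.ofReal (Real.exp (-θ * d)) else if d = 0 then 1 else 0

@[fun_prop]
theorem measurable_stepWeight (θ : ℝ) (b : Bool) : Measurable (stepWeight θ b) := by
  cases b with
  | false => exact Measurable.ite (measurableSet_singleton 0) measurable_const measurable_const
  | true =>
    change Measurable fun d => ENNReal.ofReal (Real.exp (-θ * d))
    fun_prop

/-- The total weight of the paths from the root of length between `1` and `k`. -/
def pathSum (lam θ : ℝ) : ℕ → Bool → TreeData → ℝ≥0∞
  | 0, _, _ => 0
  | k + 1, b, ω => ∑ i ∈ Finset.range (numChildren ω []),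
      stepWeight θ b (gap lam b ω i) * (1 + pathSum lam θ k (!b) (subtree ω i))

theorem measurable_sum_children {f : ℕ → TreeData → ℝ≥0∞} (hf : ∀ i, Measurable (f i)) :
    Measurable fun ω => ∑ i ∈ Finset.range (numChildren ω []), f i ω := by
  have : Measurable fun p : ℕ × TreeData => ∑ i ∈ Finset.range p.1, f i p.2 :=
    measurable_from_prod_countable_right fun n =>
      Finset.measurable_sum (Finset.range n) fun i _ => hf i
  exact this.comp (f := fun ω : TreeData => (numChildren ω [], ω)) (by fun_prop)

@[fun_prop]
theorem measurable_pathSum (lam θ : ℝ) (k : ℕ) (b : Bool) : Measurable (pathSum lam θ k b) := by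
  induction k generalizing b with
  | zero => exact measurable_const
  | succ k ih =>
    have h := ih (!b)
    exact measurable_sum_children fun i => by fun_prop

theorem pathSum_mono {lam θ : ℝ} {k l : ℕ} (hkl : k ≤ l) (b : Bool) (ω : TreeData) :
    pathSum lam θ k b ω ≤ pathSum lam θ l b ω := by
  induction k generalizing l b ω with
  | zero => exact zero_le
  | succ k ih =>
    obtain ⟨l, rfl⟩ : ∃ m, l = m + 1 := ⟨l - 1, by omega⟩
    rw [pathSum, pathSum]
    gcongr with i
    exact ih (by omega) _ _

theorem pathSum_false_succ (lam θ : ℝ) (k : ℕ) (ω : TreeData) :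
    pathSum lam θ (k + 1) false ω = ∑ i ∈ Finset.range (numChildren ω []),
      if gap lam false ω i = 0 then 1 + pathSum lam θ k true (subtree ω i) else 0 := by
  rw [pathSum]
  refine Finset.sum_congr rfl fun i _ => ?_
  simp only [stepWeight, cond_false, Bool.not_false]
  split_ifs <;> simp

theorem pathSum_true_succ (lam θ : ℝ) (k : ℕ) (ω : TreeData) :
    pathSum lam θ (k + 1) true ω = (∑ i ∈ Finset.range (numChildren ω []),
      if gap lam true ω i = 0 then 1 + pathSum lam θ k false (subtree ω i) else 0) +
      ∑ i ∈ Finset.range (numChildren ω []), if gap lam true ω i = 0 then 0 else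
        ENNReal.ofReal (Real.exp (-θ * gap lam true ω i)) *
          (1 + pathSum lam θ k false (subtree ω i)) := by
  rw [pathSum, ← Finset.sum_add_distrib]
  refine Finset.sum_congr rfl fun i _ => ?_
  simp only [stepWeight, cond_true, Bool.not_true]
  split_ifs with h
  · rw [h]; simp
  · rw [zero_add]

/-- Two generations are unfolded, one of each type. The term `2` counts the path ends at these two
generations along optimal children, the `η` term the paths with a positive deviation, and the last
integral the paths that continue optimally. -/
theorem lintegral_pathSum_step {q lam θ : ℝ} (hq : 0 < q) (hlam : 0 < lam) {η : ℝ≥0∞}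
    (hη : ∀ c, ∫⁻ x, (if c < x then ENNReal.ofReal (Real.exp (-θ * (x - c))) else 0)
      ∂(intensity q lam) ≤ η) (k : ℕ) {h : ℝ → ℝ≥0∞} (hh : Measurable h) :
    ∫⁻ ω, pathSum lam θ (k + 2) false ω * h (value lam false ω) ∂(treeLaw q lam) ≤
      (2 + η * (1 + ∫⁻ ω, pathSum lam θ k false ω ∂(treeLaw q lam))) * meanBelow q lam false h +
      ∫⁻ ω, pathSum lam θ k false ω *
        childOp q lam true (childOp q lam false h) (value lam false ω) ∂(treeLaw q lam) := by
  have := isProbabilityMeasure_treeLaw hq hlam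
  have mg := measurable_childOp q lam false hh
  set g := childOp q lam false h with hg
  clear_value g
  have mg2 := measurable_childOp q lam true mg
  set F := fun ω => 1 + pathSum lam θ k false ω with hF
  have mF : Measurable F := by fun_prop
  have e1 : ∫⁻ ω, g (value lam true ω) ∂(treeLaw q lam) ≤ meanBelow q lam false h :=
    hg ▸ lintegral_childOp_le hq hlam false hh
  have e2 : ∫⁻ ω, childOp q lam true g (value lam false ω) ∂(treeLaw q lam) ≤
      meanBelow q lam false h :=
    (lintegral_childOp_le hq hlam true mg).trans ((meanBelow_le _ _ _ _).trans e1)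
  simp only [pathSum_false_succ]
  rw [lintegral_sum_optimal hq hlam false (F := fun ω => 1 + pathSum lam θ (k + 1) true ω)
    (by fun_prop) hh, ← hg]
  simp only [add_mul, one_mul, Bool.not_false]
  rw [lintegral_add_left (by fun_prop)]
  have e3 : ∫⁻ ω, pathSum lam θ (k + 1) true ω * g (value lam true ω) ∂(treeLaw q lam) ≤
      ∫⁻ ω, F ω * childOp q lam true g (value lam false ω) ∂(treeLaw q lam) +
      η * (∫⁻ ω, F ω ∂(treeLaw q lam)) * meanBelow q lam false h := by
    simp only [pathSum_true_succ, add_mul]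
    rw [lintegral_add_left]
    · refine add_le_add (lintegral_sum_optimal hq hlam true mF mg).le ?_
      refine (lintegral_sum_discounted_le hq hlam true hη mF mg).trans ?_
      gcongr
    · refine Measurable.mul (measurable_sum_children fun i => ?_) (by fun_prop)
      exact Measurable.ite (measurableSet_eq_fun (by fun_prop) (by fun_prop)) (by fun_prop)
        measurable_const
  have e4 : ∫⁻ ω, F ω ∂(treeLaw q lam) = 1 + ∫⁻ ω, pathSum lam θ k false ω ∂(treeLaw q lam) := by
    rw [hF, lintegral_add_left measurable_const]
    simp
  have e5 : ∫⁻ ω, F ω * childOp q lam true g (value lam false ω) ∂(treeLaw q lam) ≤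
      meanBelow q lam false h + ∫⁻ ω, pathSum lam θ k false ω *
        childOp q lam true g (value lam false ω) ∂(treeLaw q lam) := by
    simp only [hF, add_mul, one_mul]
    rw [lintegral_add_left (by fun_prop)]
    gcongr
  calc _ ≤ meanBelow q lam false h + ((meanBelow q lam false h + ∫⁻ ω, pathSum lam θ k false ω *
        childOp q lam true g (value lam false ω) ∂(treeLaw q lam)) +
        η * (1 + ∫⁻ ω, pathSum lam θ k false ω ∂(treeLaw q lam)) * meanBelow q lam false h) :=
        add_le_add e1 (e3.trans (by rw [e4]; gcongr))
    _ = _ := by ring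

theorem iterOp_two_mul_succ (q lam : ℝ) (h : ℝ → ℝ≥0∞) (j : ℕ) :
    iterOp q lam h (2 * (j + 1)) =
      childOp q lam true (childOp q lam false (iterOp q lam h (2 * j))) := by
  have h0 : (2 * j).bodd = false := bodd_eq_false_iff_even.2 (even_two_mul j)
  have h1 : (2 * j + 1).bodd = true := by rw [Nat.bodd_succ, h0]; rfl
  rw [show 2 * (j + 1) = 2 * j + 1 + 1 by ring, iterOp, iterOp, h0, h1]

theorem meanBelow_iterOp_le {q lam : ℝ} (hq : 0 < q) (hlam : 0 < lam) {h : ℝ → ℝ≥0∞}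
    (hh : Measurable h) (j : ℕ) :
    meanBelow q lam false (iterOp q lam h (2 * j)) ≤ meanBelow q lam false h := by
  rcases Nat.eq_zero_or_pos j with rfl | hj
  · exact le_rfl
  · refine (meanBelow_le _ _ _ _).trans ?_
    have h0 : (2 * j).bodd = false := bodd_eq_false_iff_even.2 (even_two_mul j)
    have := antitone_lintegral_iterOp hq hlam hh (show 1 ≤ 2 * j by omega)
    simp only [h0] at this
    exact this.trans (lintegral_iterOp_succ_le hq hlam hh 0)

/-- Given the value of the root, the mean of the total weight of all paths is bounded. -/
theorem exists_lintegral_pathSum_le {q lam : ℝ} (hq : 0 < q) (hq1 : q < 1) (hlam : 0 < lam) :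
    ∃ (θ : ℝ) (C : ℝ≥0∞), 0 < θ ∧ C ≠ ∞ ∧ ∀ (k : ℕ) (h : ℝ → ℝ≥0∞), Measurable h →
      ∫⁻ ω, pathSum lam θ (2 * k) false ω * h (value lam false ω) ∂(treeLaw q lam) ≤
        C * meanBelow q lam false h := by
  have := isProbabilityMeasure_treeLaw hq hlam
  obtain ⟨r, ρ, hr, hρ, hcon⟩ := exists_iterOp_contraction hq hq1 hlam
  have hr' : (0 : ℝ) < r := by exact_mod_cast hr
  obtain ⟨κ, hκ0, hκ1, hρκ⟩ : ∃ κ : ℝ, 0 < κ ∧ κ ≤ 1 ∧ ρ = ENNReal.ofReal (1 - κ) := by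
    have h1 : ρ.toReal < 1 := by
      rw [← ENNReal.toReal_one]
      exact (ENNReal.toReal_lt_toReal hρ.ne_top ENNReal.one_ne_top).2 hρ
    refine ⟨1 - ρ.toReal, by linarith, by linarith [ρ.toReal_nonneg], ?_⟩
    rw [sub_sub_cancel, ENNReal.ofReal_toReal hρ.ne_top]
  obtain ⟨θ, hθ, hη⟩ := exists_discount hq hq1 lam (η := κ / (2 * r)) (by positivity)
  -- The solution of `r * (2 + κ / (2 * r) * (1 + c)) + c * (1 - κ) = c`: the discount `κ / (2 * r)`
  -- uses up only half of the gain `κ` over `r` double steps.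
  set c : ℝ := (4 * r + κ) / κ with hc
  have hc0 : 0 < c := by positivity
  set C := ENNReal.ofReal c with hC
  set A : ℝ≥0∞ := 2 + ENNReal.ofReal (κ / (2 * r)) * (1 + C) with hA
  have hbal : r * A + C * ρ ≤ C := by
    have e1 : (r : ℝ≥0∞) * A + C * ρ =
        ENNReal.ofReal (r * (2 + κ / (2 * r) * (1 + c)) + c * (1 - κ)) := by
      rw [ENNReal.ofReal_add (by positivity) (mul_nonneg hc0.le (by linarith)),
        ENNReal.ofReal_mul hr'.le, ENNReal.ofReal_add (by norm_num) (by positivity),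
        ENNReal.ofReal_mul (by positivity), ENNReal.ofReal_add (by norm_num) hc0.le,
        ENNReal.ofReal_mul hc0.le, hρκ, hA, hC]
      simp
    rw [e1]
    refine ENNReal.ofReal_le_ofReal (le_of_eq ?_)
    rw [hc]
    field_simp
    ring
  refine ⟨θ, C, hθ, ENNReal.ofReal_ne_top, fun k => ?_⟩
  induction k using Nat.strong_induction_on with
  | _ k ih =>
  intro h hh
  -- Each of `j` double steps costs `A` times the same mean, since `childOp` does not increase mass.
  have iter : ∀ j ≤ k, ∫⁻ ω, pathSum lam θ (2 * k) false ω * h (value lam false ω)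
      ∂(treeLaw q lam) ≤ j * A * meanBelow q lam false h +
      ∫⁻ ω, pathSum lam θ (2 * (k - j)) false ω * iterOp q lam h (2 * j) (value lam false ω)
        ∂(treeLaw q lam) := by
    intro j
    induction j with
    | zero => intro _; simp [iterOp]
    | succ j ihj =>
      intro hj
      refine (ihj (by omega)).trans ?_
      obtain ⟨l, hl⟩ : ∃ l, k - j = l + 1 := ⟨k - j - 1, by omega⟩
      have hl' : k - (j + 1) = l := by omega
      -- The decoupled subtree carries no test function, so the induction hypothesis is used with `h
      -- = 1`.
      have hP : ∫⁻ ω, pathSum lam θ (2 * l) false ω ∂(treeLaw q lam) ≤ C := by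
        have h1 := ih l (by omega) (fun _ => 1) measurable_const
        simp only [mul_one] at h1
        refine h1.trans (mul_le_of_le_one_right zero_le ?_)
        refine (meanBelow_le _ _ _ _).trans ?_
        simp
      rw [hl, hl', show 2 * (l + 1) = 2 * l + 2 by ring, iterOp_two_mul_succ]
      calc _ ≤ j * A * meanBelow q lam false h + ((2 + ENNReal.ofReal (κ / (2 * r)) * (1 + ∫⁻ ω,
            pathSum lam θ (2 * l) false ω ∂(treeLaw q lam))) *
            meanBelow q lam false (iterOp q lam h (2 * j)) + _) := by
            gcongr
            exact lintegral_pathSum_step hq hlam hη (2 * l) (measurable_iterOp q lam hh (2 * j))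
        _ ≤ j * A * meanBelow q lam false h + (A * meanBelow q lam false h + _) := by
            rw [hA]
            gcongr
            exact meanBelow_iterOp_le hq hlam hh j
        _ = _ := by push_cast; ring
  -- Either the levels run out before the contraction is needed, or `r` double steps are made and
  -- the contraction absorbs the remainder.
  rcases lt_or_ge k r with hkr | hkr
  · refine (iter k le_rfl).trans ?_
    rw [Nat.sub_self, mul_zero]
    simp only [pathSum, zero_mul, lintegral_zero, add_zero]
    gcongr
    calc (k : ℝ≥0∞) * A ≤ r * A := by gcongr
      _ ≤ r * A + C * ρ := le_self_add
      _ ≤ C := hbal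
  · refine (iter r hkr).trans ?_
    have h1 := ih (k - r) (by omega) _ (measurable_iterOp q lam hh (2 * r))
    calc _ ≤ r * A * meanBelow q lam false h + C * (ρ * meanBelow q lam false h) := by
          gcongr
          refine h1.trans ?_
          gcongr
          exact (meanBelow_le _ _ _ _).trans (hcon h hh)
      _ = (r * A + C * ρ) * meanBelow q lam false h := by ring
      _ ≤ _ := by gcongr

/-! ### Reasonable paths, explored from the root -/

/-- `Reaches lam b ω t r` says that the path from the root with the child indices `r` is a
reasonable path with budget `t`; `b` tells whether deviations are allowed at the first step. -/
def Reaches (lam : ℝ) : Bool → TreeData → ℝ → List ℕ → Prop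
  | _, _, t, [] => 0 ≤ t
  | b, ω, t, i :: r => i < numChildren ω [] ∧ (b = false → gap lam b ω i = 0) ∧
      Reaches lam (!b) (subtree ω i) (t - gap lam b ω i) r

theorem Reaches.nonneg {lam : ℝ} (hlam : 0 ≤ lam) {b : Bool} {ω : TreeData} {t : ℝ} {r : List ℕ}
    (h : Reaches lam b ω t r) : 0 ≤ t := by
  induction r generalizing b ω t with
  | nil => exact h
  | cons i r ih =>
    have := ih h.2.2
    have := gap_nonneg hlam b ω h.1
    linarith

theorem Reaches.of_append {lam : ℝ} (hlam : 0 ≤ lam) {b : Bool} {ω : TreeData} {t : ℝ}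
    {r s : List ℕ} (h : Reaches lam b ω t (r ++ s)) : Reaches lam b ω t r := by
  induction r generalizing b ω t with
  | nil => exact h.nonneg hlam
  | cons i r ih => exact ⟨h.1, h.2.1, ih h.2.2⟩

/-- The Chernoff bound, by induction over the first step: a path that ends with remaining budget `u
≥ 0` counts `1 ≤ exp (θ * u)`. -/
theorem encard_reaches_le {lam θ : ℝ} (hθ : 0 ≤ θ) (k : ℕ) (b : Bool)
    (ω : TreeData) (t : ℝ) :
    (({r | r ≠ [] ∧ r.length ≤ k ∧ Reaches lam b ω t r}.encard : ℕ∞) : ℝ≥0∞) ≤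
      ENNReal.ofReal (Real.exp (θ * t)) * pathSum lam θ k b ω := by
  induction k generalizing b ω t with
  | zero =>
    have : {r : List ℕ | r ≠ [] ∧ r.length ≤ 0 ∧ Reaches lam b ω t r} = ∅ := by
      ext r
      simp only [mem_ofPred_eq, mem_empty_iff_false, iff_false, nonpos_iff_eq_zero,
        List.length_eq_zero_iff]
      exact fun h => h.1 h.2.1
    rw [this]; simp
  | succ k ih =>
    set S : ℕ → Set (List ℕ) := fun i => {r | (b = false → gap lam b ω i = 0) ∧ r.length ≤ k ∧
      Reaches lam (!b) (subtree ω i) (t - gap lam b ω i) r} with hS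
    have hsub : {r | r ≠ [] ∧ r.length ≤ k + 1 ∧ Reaches lam b ω t r} ⊆
        ⋃ i ∈ Finset.range (numChildren ω []), List.cons i '' S i := by
      rintro (_ | ⟨i, r⟩) ⟨h0, hlen, h⟩
      · exact absurd rfl h0
      · simp only [mem_iUnion, Finset.mem_range]
        exact ⟨i, h.1, r, ⟨h.2.1, by simpa using hlen, h.2.2⟩, rfl⟩
    have hunion : ∀ s : Finset ℕ, ((⋃ i ∈ s, List.cons i '' S i).encard : ℝ≥0∞) ≤
        ∑ i ∈ s, ((S i).encard : ℝ≥0∞) := by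
      intro s
      induction s using Finset.induction_on with
      | empty => simp
      | insert i s hi ihs =>
        rw [Finset.set_biUnion_insert, Finset.sum_insert hi]
        calc _ ≤ (((List.cons i '' S i).encard + (⋃ i ∈ s, List.cons i '' S i).encard : ℕ∞) :
              ℝ≥0∞) := by exact_mod_cast encard_union_le _ _
          _ ≤ _ := by
              rw [ENat.toENNReal_add]
              exact add_le_add (ENat.toENNReal_le.2 (encard_image_le _ _)) ihs
    have hone : ∀ i, ((S i).encard : ℝ≥0∞) ≤ ENNReal.ofReal (Real.exp (θ * t)) *
        (stepWeight θ b (gap lam b ω i) * (1 + pathSum lam θ k (!b) (subtree ω i))) := by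
      intro i
      by_cases hb : b = false → gap lam b ω i = 0
      swap
      · have : S i = ∅ := by
          ext r; simp only [hS, mem_ofPred_eq, mem_empty_iff_false, iff_false]
          exact fun h => hb h.1
        rw [this]; simp
      set u := t - gap lam b ω i with hu
      have hw : ENNReal.ofReal (Real.exp (θ * u)) =
          ENNReal.ofReal (Real.exp (θ * t)) * stepWeight θ b (gap lam b ω i) := by
        cases b with
        | false => rw [hu, hb rfl, sub_zero]; simp [stepWeight]
        | true =>
          rw [stepWeight, cond_true, ← ENNReal.ofReal_mul (Real.exp_pos _).le, ← Real.exp_add, hu]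
          congr 2; ring
      have h1 : S i ⊆ {r | r = [] ∧ 0 ≤ u} ∪
          {r | r ≠ [] ∧ r.length ≤ k ∧ Reaches lam (!b) (subtree ω i) u r} := by
        rintro (_ | ⟨j, r⟩) ⟨-, hlen, h⟩
        · exact Or.inl ⟨rfl, h⟩
        · exact Or.inr ⟨List.cons_ne_nil _ _, hlen, h⟩
      have h2 : (({r : List ℕ | r = [] ∧ 0 ≤ u}.encard : ℕ∞) : ℝ≥0∞) ≤
          ENNReal.ofReal (Real.exp (θ * u)) := by
        by_cases hu0 : 0 ≤ u
        · simp only [hu0, and_true]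
          have : {r : List ℕ | r = []} = {[]} := rfl
          rw [this, encard_singleton, ENat.toENNReal_one, ENNReal.one_le_ofReal]
          exact Real.one_le_exp (by positivity)
        · simp [hu0]
      rw [← mul_assoc, ← hw, mul_add, mul_one]
      calc _ ≤ ((({r : List ℕ | r = [] ∧ 0 ≤ u}.encard +
            {r | r ≠ [] ∧ r.length ≤ k ∧ Reaches lam (!b) (subtree ω i) u r}.encard : ℕ∞)) :
            ℝ≥0∞) := by exact_mod_cast (encard_le_encard h1).trans (encard_union_le _ _)
        _ ≤ _ := by
            rw [ENat.toENNReal_add]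
            exact add_le_add h2 (ih _ _ _)
    calc _ ≤ ((⋃ i ∈ Finset.range (numChildren ω []), List.cons i '' S i).encard : ℝ≥0∞) := by
          exact_mod_cast encard_le_encard hsub
      _ ≤ ∑ i ∈ Finset.range (numChildren ω []), ((S i).encard : ℝ≥0∞) := hunion _
      _ ≤ _ := by
          rw [pathSum, Finset.mul_sum]
          exact Finset.sum_le_sum fun i _ => hone i

/-- The deviation, computed from the alternating valuation; `b` is the type of the root. -/
def altDeviation (lam : ℝ) (b : Bool) (ω : TreeData) : List ℕ → ℝ
  | [] => 0
  | i :: u => gap lam (b ^^ u.length.bodd) (descendants ω u) i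

theorem deviation_eq {lam : ℝ} (hlam : 0 ≤ lam) {ω : TreeData} (hω : ∀ u i, 0 ≤ edgeCost ω u i)
    {v : List ℕ} (hv : IsVertex ω v) : deviation lam ω v = altDeviation lam false ω v := by
  cases v with
  | nil => rfl
  | cons i u =>
    have h1 : |edgeCost (descendants ω u) [] i| = edgeCost ω u i := abs_of_nonneg (hω u i)
    rw [deviation, altDeviation, gap, h1, fA_eq_alternatingValue hlam hω hv.1,
      fA_eq_alternatingValue hlam hω hv, alternatingValue, alternatingValue, subtree_descendants,
      Bool.false_xor, List.length_cons, Nat.bodd_succ]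

theorem altDeviation_append {lam : ℝ} (b : Bool) (ω : TreeData) (i : ℕ) {w : List ℕ}
    (hw : w ≠ []) :
    altDeviation lam b ω (w ++ [i]) = altDeviation lam (!b) (subtree ω i) w := by
  cases w with
  | nil => exact absurd rfl hw
  | cons j u =>
    rw [List.cons_append, altDeviation, altDeviation, descendants_append, List.length_append,
      List.length_singleton, Nat.bodd_succ]
    simp

theorem altDeviation_singleton (lam : ℝ) (b : Bool) (ω : TreeData) (i : ℕ) :
    altDeviation lam b ω [i] = gap lam b ω i := by
  simp [altDeviation, descendants_nil]

theorem isVertex_append {ω : TreeData} {u : List ℕ} {i : ℕ} :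
    IsVertex ω (u ++ [i]) ↔ i < numChildren ω [] ∧ IsVertex (subtree ω i) u := by
  induction u with
  | nil => simp [IsVertex]
  | cons j u ih =>
    rw [List.cons_append, IsVertex, IsVertex, ih, and_assoc]
    rfl

theorem isVertex_of_suffix {ω : TreeData} {u v : List ℕ} (h : u <:+ v) (hv : IsVertex ω v) :
    IsVertex ω u := by
  induction v with
  | nil => rw [List.suffix_nil.1 h]; trivial
  | cons i v ih =>
    rcases List.suffix_cons_iff.1 h with rfl | h
    exacts [hv, ih h hv.1]

theorem sum_altDeviation_append (lam : ℝ) (b : Bool) (ω : TreeData) (i : ℕ) (u : List ℕ) :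
    ((u ++ [i]).tails.map (altDeviation lam b ω)).sum =
      gap lam b ω i + (u.tails.map (altDeviation lam (!b) (subtree ω i))).sum := by
  induction u with
  | nil => simp [altDeviation, descendants_nil]
  | cons j u ih =>
    have := altDeviation_append (lam := lam) b ω i (List.cons_ne_nil j u)
    rw [List.cons_append] at this
    rw [List.cons_append, List.tails_cons, List.tails_cons, List.map_cons, List.map_cons,
      List.sum_cons, List.sum_cons, ih, this]
    ring

/-- A version of `IsReasonable` that uses the alternating valuation. -/
def IsAltReasonable (lam : ℝ) (b : Bool) (ω : TreeData) (t : ℝ) (v : List ℕ) : Prop :=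
  IsVertex ω v ∧ (v.tails.map (altDeviation lam b ω)).sum ≤ t ∧
    ∀ w, w <:+ v → (b ^^ w.length.bodd) = true → altDeviation lam b ω w = 0

theorem isReasonable_iff {lam : ℝ} (hlam : 0 ≤ lam) {ω : TreeData}
    (hω : ∀ u i, 0 ≤ edgeCost ω u i) {t : ℝ} {v : List ℕ} :
    IsReasonable lam ω t v ↔ IsAltReasonable lam false ω t v := by
  refine and_congr_right fun hv => ?_
  have h : ∀ w, w <:+ v → deviation lam ω w = altDeviation lam false ω w := fun w hw =>
    deviation_eq hlam hω (isVertex_of_suffix hw hv)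
  have h1 : v.tails.map (deviation lam ω) = v.tails.map (altDeviation lam false ω) :=
    List.map_congr_left fun w hw => h w ((List.mem_tails _ _).1 hw)
  rw [h1]
  refine and_congr_right fun _ => forall_congr' fun w => ?_
  refine forall_congr' fun hw => ?_
  rw [h w hw, Bool.false_xor, bodd_eq_true_iff_odd]

/-- Words list the last step first whereas `Reaches` consumes the first step first, hence the
reversal. -/
theorem IsAltReasonable.reaches {lam : ℝ} {b : Bool} {ω : TreeData} {t : ℝ} {v : List ℕ}
    (h : IsAltReasonable lam b ω t v) : Reaches lam b ω t v.reverse := by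
  induction v using List.reverseRecOn generalizing b ω t with
  | nil => simpa [Reaches, altDeviation] using h.2.1
  | append_singleton u i ih =>
    obtain ⟨h1, h2, h3⟩ := h
    rw [isVertex_append] at h1
    rw [sum_altDeviation_append] at h2
    rw [List.reverse_append, List.reverse_singleton, List.singleton_append]
    refine ⟨h1.1, fun hb => ?_, ih ⟨h1.2, by linarith, fun w hw hw' => ?_⟩⟩
    · rw [← altDeviation_singleton]
      refine h3 [i] (List.suffix_append _ _) ?_
      rw [hb]; simp
    · rcases eq_or_ne w [] with rfl | hw0
      · rfl
      · rw [← altDeviation_append b ω i hw0]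
        refine h3 _ ?_ ?_
        · obtain ⟨s, rfl⟩ := hw
          exact ⟨s, by simp⟩
        · rw [List.length_append, List.length_singleton, Nat.bodd_succ, ← hw']
          simp

theorem reaches_of_mem_reasonableTree {lam : ℝ} (hlam : 0 ≤ lam) {ω : TreeData}
    (hω : ∀ u i, 0 ≤ edgeCost ω u i) {t : ℝ} {u : List ℕ} (hu : u ∈ reasonableTree lam ω t) :
    Reaches lam false ω t u.reverse := by
  obtain ⟨v, hv, huv⟩ := hu
  have h := ((isReasonable_iff hlam hω).1 hv).reaches
  obtain ⟨s, hs⟩ := List.reverse_prefix.2 huv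
  rw [← hs] at h
  exact h.of_append hlam

theorem truncSize_le {lam θ : ℝ} (hlam : 0 ≤ lam) (hθ : 0 ≤ θ) {ω : TreeData}
    (hω : ∀ u i, 0 ≤ edgeCost ω u i) (k : ℕ) (t : ℝ) :
    truncSize lam k t ω ≤ ENNReal.ofReal (Real.exp (θ * t)) * pathSum lam θ k false ω := by
  refine le_trans ?_ (encard_reaches_le hθ k false ω t)
  rw [truncSize, ← (List.reverse_injective.injOn).encard_image]
  norm_cast
  refine encard_le_encard ?_
  rintro _ ⟨u, ⟨hu, h0, hlen⟩, rfl⟩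
  exact ⟨by simpa using h0, by simpa using hlen, reaches_of_mem_reasonableTree hlam hω hu⟩

theorem truncSize_mono {lam : ℝ} {k l : ℕ} (hkl : k ≤ l) (t : ℝ) (ω : TreeData) :
    truncSize lam k t ω ≤ truncSize lam l t ω := by
  rw [truncSize, truncSize]
  norm_cast
  exact encard_le_encard fun u hu => ⟨hu.1, hu.2.1, hu.2.2.trans hkl⟩

/-- The tree of reasonable paths is finite if the sizes of its truncations are bounded. -/
theorem finite_of_truncSize_le {lam t : ℝ} {ω : TreeData} {B : ℝ≥0∞} (hB : B ≠ ∞)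
    (h : ∀ k, truncSize lam k t ω ≤ B) : (reasonableTree lam ω t).Finite := by
  by_contra hinf
  have hinf' : (reasonableTree lam ω t \ {[]}).Infinite :=
    Set.Infinite.sdiff hinf (finite_singleton _)
  obtain ⟨n, hn⟩ := ENNReal.exists_nat_gt hB
  obtain ⟨s, hs, hcard⟩ := hinf'.exists_subset_card_eq n
  obtain ⟨k, hk⟩ : ∃ k, ∀ u ∈ s, u.length ≤ k :=
    ⟨s.sup List.length, fun u hu => Finset.le_sup (f := List.length) hu⟩
  have h1 : ((s : Set (List ℕ)).encard : ℝ≥0∞) ≤ truncSize lam k t ω := by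
    refine ENat.toENNReal_le.2 (encard_le_encard fun u hu => ?_)
    exact ⟨(hs hu).1, (hs hu).2, hk u hu⟩
  rw [encard_coe_eq_coe_finsetCard, hcard] at h1
  have := h1.trans (h k)
  simp only [ENat.toENNReal_coe] at this
  exact absurd hn (not_lt.2 this)

/-! ### Measurability -/

theorem measurable_altDeviation (lam : ℝ) (b : Bool) (v : List ℕ) :
    Measurable fun ω => altDeviation lam b ω v := by
  cases v with
  | nil => exact measurable_const
  | cons i u => exact (measurable_gap lam _ i).comp (measurable_descendants u)

theorem measurableSet_isVertex (v : List ℕ) : MeasurableSet {ω | IsVertex ω v} := by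
  induction v with
  | nil => exact MeasurableSet.univ
  | cons i u ih =>
    exact ih.inter (measurableSet_lt measurable_const (measurable_numChildren u))

theorem measurable_list_map_sum {α : Type*} [MeasurableSpace α] {ι : Type*} {f : ι → α → ℝ}
    (hf : ∀ i, Measurable (f i)) (l : List ι) :
    Measurable fun x => (l.map fun i => f i x).sum := by
  induction l with
  | nil => exact measurable_const
  | cons i l ih =>
    simp only [List.map_cons, List.sum_cons]
    exact (hf i).add ih

theorem measurableSet_isAltReasonable (lam : ℝ) (b : Bool) (t : ℝ) (v : List ℕ) :
    MeasurableSet {ω | IsAltReasonable lam b ω t v} := by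
  refine (measurableSet_isVertex v).inter (MeasurableSet.inter ?_ ?_)
  · exact measurableSet_le (measurable_list_map_sum
      (f := fun v ω => altDeviation lam b ω v) (measurable_altDeviation lam b) v.tails)
      measurable_const
  · have : {ω | ∀ w, w <:+ v → (b ^^ w.length.bodd) = true → altDeviation lam b ω w = 0} =
        ⋂ w, ⋂ (_ : w <:+ v), ⋂ (_ : (b ^^ w.length.bodd) = true),
          {ω | altDeviation lam b ω w = 0} := by
      ext ω; simp
    change MeasurableSet {ω | ∀ w, w <:+ v → (b ^^ w.length.bodd) = true →
      altDeviation lam b ω w = 0}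
    rw [this]
    exact MeasurableSet.iInter fun w => MeasurableSet.iInter fun _ => MeasurableSet.iInter fun _ =>
      measurableSet_eq_fun (measurable_altDeviation lam b w) measurable_const

/-- A measurable version of `truncSize`. -/
def altTruncSize (lam : ℝ) (k : ℕ) (t : ℝ) (ω : TreeData) : ℝ≥0∞ :=
  ∑' u : List ℕ, indicator {ω | (∃ v, IsAltReasonable lam false ω t v ∧ u <:+ v) ∧
    u ≠ [] ∧ u.length ≤ k} 1 ω

theorem measurable_altTruncSize (lam : ℝ) (k : ℕ) (t : ℝ) : Measurable (altTruncSize lam k t) := by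
  refine Measurable.tsum fun u => measurable_one.indicator ?_
  refine MeasurableSet.inter ?_ (MeasurableSet.const _)
  have : {ω | ∃ v, IsAltReasonable lam false ω t v ∧ u <:+ v} =
      ⋃ v, {ω | IsAltReasonable lam false ω t v} ∩ {_ω | u <:+ v} := by
    ext ω; simp
  change MeasurableSet {ω | ∃ v, IsAltReasonable lam false ω t v ∧ u <:+ v}
  rw [this]
  exact MeasurableSet.iUnion fun v =>
    (measurableSet_isAltReasonable lam false t v).inter (MeasurableSet.const _)

theorem truncSize_eq {lam : ℝ} (hlam : 0 ≤ lam) {ω : TreeData}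
    (hω : ∀ u i, 0 ≤ edgeCost ω u i) (k : ℕ) (t : ℝ) :
    truncSize lam k t ω = altTruncSize lam k t ω := by
  rw [truncSize, altTruncSize, ← ENNReal.tsum_set_one,
    tsum_subtype {u ∈ reasonableTree lam ω t | u ≠ [] ∧ u.length ≤ k} (fun _ => (1 : ℝ≥0∞))]
  refine tsum_congr fun u => ?_
  have h : u ∈ {u ∈ reasonableTree lam ω t | u ≠ [] ∧ u.length ≤ k} ↔
      ω ∈ {ω | (∃ v, IsAltReasonable lam false ω t v ∧ u <:+ v) ∧ u ≠ [] ∧ u.length ≤ k} :=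
    and_congr_left fun _ => exists_congr fun v => and_congr_left fun _ =>
      isReasonable_iff hlam hω
  by_cases hu : u ∈ {u ∈ reasonableTree lam ω t | u ≠ [] ∧ u.length ≤ k}
  · rw [indicator_of_mem hu, indicator_of_mem (h.1 hu), Pi.one_apply]
  · rw [indicator_of_notMem hu, indicator_of_notMem (mt h.2 hu)]

/-! ### Elementary conditional expectations -/

theorem condMeanAt_congr {Ω : Type*} [MeasurableSpace Ω] {P : Measure Ω} {X X' : Ω → ℝ≥0∞}
    {Y Y' : Ω → ℝ} (hX : X =ᵐ[P] X') (hY : Y =ᵐ[P] Y') (z : ℝ) :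
    condMeanAt P X Y z = condMeanAt P X' Y' z := by
  have h : ∀ ε : ℝ, {ω | |Y ω - z| ≤ ε} =ᵐ[P] {ω | |Y' ω - z| ≤ ε} := fun ε => by
    filter_upwards [hY] with ω hω
    exact propext (by change |Y ω - z| ≤ ε ↔ |Y' ω - z| ≤ ε; rw [hω])
  rw [condMeanAt, condMeanAt]
  congr 1
  ext ε
  rw [setLIntegral_congr (h ε), measure_congr (h ε), lintegral_congr_ae (ae_restrict_of_ae hX)]

theorem IsCondMean.congr {Ω : Type*} [MeasurableSpace Ω] {P : Measure Ω} {X X' : Ω → ℝ≥0∞}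
    {Y Y' : Ω → ℝ} {g : ℝ → ℝ≥0∞} (h : IsCondMean P X' Y' g) (hX : X =ᵐ[P] X')
    (hY : Y =ᵐ[P] Y') : IsCondMean P X Y g := by
  obtain ⟨h1, h2, h3, h4⟩ := h
  have hmap : P.map Y = P.map Y' := Measure.map_congr hY
  refine ⟨h1.congr hX.symm, h2.congr hY.symm, hmap ▸ h3, fun B hB => ?_⟩
  have hset : Y ⁻¹' B =ᵐ[P] Y' ⁻¹' B := by
    filter_upwards [hY] with ω hω
    exact propext (by change Y ω ∈ B ↔ Y' ω ∈ B; rw [hω])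
  rw [hmap, ← h4 B hB, setLIntegral_congr hset, lintegral_congr_ae (ae_restrict_of_ae hX)]

/-- The pointwise conditional expectation is a version of the conditional expectation. -/
theorem isCondMean_condMeanAt {Ω : Type*} [MeasurableSpace Ω] {P : Measure Ω}
    [IsFiniteMeasure P] {X : Ω → ℝ≥0∞} {Y : Ω → ℝ} (hX : Measurable X) (hY : Measurable Y)
    (hfin : ∫⁻ ω, X ω ∂P ≠ ∞) : IsCondMean P X Y (condMeanAt P X Y) := by
  have := isFiniteMeasure_withDensity hfin
  set ρ := (P.withDensity X).map Y with hρ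
  have hρB : ∀ B, MeasurableSet B → ρ B = ∫⁻ ω in Y ⁻¹' B, X ω ∂P := fun B hB => by
    rw [hρ, Measure.map_apply hY hB, withDensity_apply _ (hY hB)]
  have hac : ρ ≪ P.map Y := (withDensity_absolutelyContinuous P X).map hY
  have hball : ∀ z ε, {ω | |Y ω - z| ≤ ε} = Y ⁻¹' Metric.closedBall z ε := fun z ε => by
    ext ω; simp [Real.dist_eq]
  -- By Besicovitch differentiation the ratios over small closed balls converge almost everywhere to
  -- the density, so the upper limit is a limit there.
  have hae : condMeanAt P X Y =ᵐ[P.map Y] ρ.rnDeriv (P.map Y) := by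
    filter_upwards [Besicovitch.ae_tendsto_rnDeriv ρ (P.map Y)] with z hz
    rw [condMeanAt, ← hz.limsup_eq]
    congr 1
    ext ε
    rw [hball, ← hρB _ Metric.isClosed_closedBall.measurableSet,
      Measure.map_apply (μ := P) hY Metric.isClosed_closedBall.measurableSet]
  refine ⟨hX.aemeasurable, hY.aemeasurable,
    (Measure.measurable_rnDeriv ρ (P.map Y)).aemeasurable.congr hae.symm, fun B hB => ?_⟩
  rw [lintegral_congr_ae (ae_restrict_of_ae hae), Measure.setLIntegral_rnDeriv hac, hρB B hB]

/-- Valid at every `z`, including those outside the support: when the event is null, the hypothesis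
makes the numerator `0`, and `0 / 0 = 0`. -/
theorem condMeanAt_le {Ω : Type*} [MeasurableSpace Ω] {P : Measure Ω} {X : Ω → ℝ≥0∞} {Y : Ω → ℝ}
    {C : ℝ≥0∞} {z : ℝ} (h : ∀ ε, ∫⁻ ω in {ω | |Y ω - z| ≤ ε}, X ω ∂P ≤
      C * P {ω | |Y ω - z| ≤ ε}) : condMeanAt P X Y z ≤ C :=
  limsup_le_of_le (h := Eventually.of_forall fun ε => ENNReal.div_le_of_le_mul (h ε))

/-! ### Conclusion -/

theorem rootValue_eq {lam : ℝ} (hlam : 0 ≤ lam) {ω : TreeData}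
    (hω : ∀ u i, 0 ≤ edgeCost ω u i) : rootValue lam ω = value lam false ω := by
  rw [rootValue, fA_eq_alternatingValue hlam hω (u := []) trivial, alternatingValue, descendants_nil]
  rfl

/-- The core bound tested on indicators, the form needed for conditioning on small balls. -/
theorem exists_setLIntegral_pathSum_le {q lam : ℝ} (hq : 0 < q) (hq1 : q < 1) (hlam : 0 < lam) :
    ∃ (θ : ℝ) (C : ℝ≥0∞), 0 < θ ∧ C ≠ ∞ ∧ ∀ (k : ℕ) (B : Set ℝ), MeasurableSet B →
      ∫⁻ ω in value lam false ⁻¹' B, pathSum lam θ (2 * k) false ω ∂(treeLaw q lam) ≤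
        C * treeLaw q lam (value lam false ⁻¹' B) := by
  obtain ⟨θ, C, hθ, hC, h⟩ := exists_lintegral_pathSum_le hq hq1 hlam
  refine ⟨θ, C, hθ, hC, fun k B hB => ?_⟩
  have hB' : MeasurableSet (value lam false ⁻¹' B) := measurable_value lam false hB
  have h1 := (h k (indicator B 1) (measurable_one.indicator hB)).trans
    (mul_le_mul_right (meanBelow_le _ _ _ _) C)
  have e1 : ∀ ω, indicator B (1 : ℝ → ℝ≥0∞) (value lam false ω) =
      indicator (value lam false ⁻¹' B) (fun _ => 1) ω := fun ω => rfl
  simp only [e1] at h1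
  rw [lintegral_indicator_const hB', one_mul] at h1
  refine le_trans (le_of_eq ?_) h1
  rw [← lintegral_indicator hB']
  refine lintegral_congr fun ω => ?_
  simp only [indicator]
  split_ifs <;> simp

end Exploration

end

theorem mainTheorem3 (q lam : ℝ) (hq0 : 0 < q) (hq1 : q < 1) (hlam : 0 < lam) :
    (∀ (k : ℕ), ∀ t ∈ Set.Icc 0 (2 * lam),
      Exploration.IsCondMean (Exploration.treeLaw q lam) (Exploration.truncSize lam k t)
        (Exploration.rootValue lam) (Exploration.meanSize q lam k t)) ∧
    (∃ Ψ : ℝ → ℝ → ℝ,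
      (∀ t ∈ Set.Icc 0 (2 * lam), ContinuousOn (Ψ t) (Set.Icc (-(lam / 2)) (lam / 2))) ∧
      (∃ C : ℝ, ∀ t ∈ Set.Icc 0 (2 * lam), ∀ z ∈ Set.Icc (-(lam / 2)) (lam / 2), Ψ t z ≤ C) ∧
      (∀ (k : ℕ), ∀ t ∈ Set.Icc 0 (2 * lam), ∀ z ∈ Set.Icc (-(lam / 2)) (lam / 2),
        Exploration.meanSize q lam (2 * k) t z < ENNReal.ofReal (Ψ t z))) ∧
    (∀ᵐ ω ∂(Exploration.treeLaw q lam), ∀ t ∈ Set.Icc 0 (2 * lam),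
      (Exploration.reasonableTree lam ω t).Finite) := by
  open Exploration in
  have := isProbabilityMeasure_treeLaw hq0 hlam
  obtain ⟨θ, C, hθ, hC, hpath⟩ := exists_setLIntegral_pathSum_le hq0 hq1 hlam
  have hgood := ae_edgeCost_nonneg hq0 hlam
  set E := ENNReal.ofReal (Real.exp (θ * (2 * lam))) with hE
  have hE' : E ≠ ∞ := ENNReal.ofReal_ne_top
  have hY : rootValue lam =ᵐ[treeLaw q lam] value lam false :=
    hgood.mono fun ω hω => rootValue_eq hlam.le hω
  have hX : ∀ k t, truncSize lam k t =ᵐ[treeLaw q lam] altTruncSize lam k t := fun k t =>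
    hgood.mono fun ω hω => truncSize_eq hlam.le hω k t
  have hle : ∀ k, ∀ t ≤ 2 * lam, ∀ᵐ ω ∂(treeLaw q lam),
      altTruncSize lam k t ω ≤ E * pathSum lam θ k false ω := by
    intro k t ht
    filter_upwards [hgood] with ω hω
    rw [← truncSize_eq hlam.le hω]
    refine (truncSize_le hlam.le hθ.le hω k t).trans ?_
    rw [hE]
    gcongr
  have hmean : ∀ k, ∀ t ≤ 2 * lam, ∀ B, MeasurableSet B →
      ∫⁻ ω in value lam false ⁻¹' B, altTruncSize lam (2 * k) t ω ∂(treeLaw q lam) ≤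
        E * C * treeLaw q lam (value lam false ⁻¹' B) := by
    intro k t ht B hB
    calc _ ≤ ∫⁻ ω in value lam false ⁻¹' B, E * pathSum lam θ (2 * k) false ω ∂(treeLaw q lam) :=
          lintegral_mono_ae (ae_restrict_of_ae (hle (2 * k) t ht))
      _ ≤ _ := by
          rw [lintegral_const_mul _ (measurable_pathSum lam θ _ _), mul_assoc]
          gcongr
          exact hpath k B hB
  -- The bound is uniform in `z` and `t`, so a constant serves as `Ψ`; the summand `1` makes the
  -- inequality strict.
  refine ⟨fun k t ht => ?_, ⟨fun _ _ => (E * C).toReal + 1, ?_, ⟨(E * C).toReal + 1, ?_⟩, ?_⟩, ?_⟩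
  · have e : meanSize q lam k t =
        condMeanAt (treeLaw q lam) (altTruncSize lam k t) (value lam false) :=
      funext fun z => condMeanAt_congr (hX k t) hY z
    rw [e]
    refine IsCondMean.congr (isCondMean_condMeanAt (measurable_altTruncSize lam k t)
      (measurable_value lam false) ?_) (hX k t) hY
    -- The mean bound is available for even levels only; level `k` is contained in level `2 * k`.
    have h1 := hmean k t ht.2 univ MeasurableSet.univ
    rw [preimage_univ, Measure.restrict_univ, measure_univ, mul_one,
      ← lintegral_congr_ae (hX (2 * k) t)] at h1
    rw [← lintegral_congr_ae (hX k t)]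
    refine ne_top_of_le_ne_top (ENNReal.mul_ne_top hE' hC) (le_trans ?_ h1)
    exact lintegral_mono fun ω => truncSize_mono (by omega) t ω
  · exact fun t _ => continuousOn_const
  · exact fun t _ z _ => le_rfl
  · intro k t ht z _
    have h1 : meanSize q lam (2 * k) t z ≤ E * C := by
      rw [meanSize, condMeanAt_congr (hX (2 * k) t) hY z]
      refine condMeanAt_le fun ε => ?_
      have hball : {ω | |value lam false ω - z| ≤ ε} =
          value lam false ⁻¹' Metric.closedBall z ε := by
        ext ω; simp [Real.dist_eq]
      rw [hball]
      exact hmean k t ht.2 _ Metric.isClosed_closedBall.measurableSet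
    refine h1.trans_lt ?_
    rw [ENNReal.lt_ofReal_iff_toReal_lt (ENNReal.mul_ne_top hE' hC)]
    linarith
  -- The total weight over all levels is almost surely finite and does not involve `t`, so a single
  -- null set serves all budgets.
  · have h1 : ∫⁻ ω, ⨆ k, pathSum lam θ (2 * k) false ω ∂(treeLaw q lam) ≤ C := by
      rw [lintegral_iSup (fun k => measurable_pathSum lam θ _ _)
        (fun k l hkl ω => pathSum_mono (by omega) _ _)]
      refine iSup_le fun k => ?_
      have := hpath k univ MeasurableSet.univ
      rwa [preimage_univ, Measure.restrict_univ, measure_univ, mul_one] at this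
    have h2 := ae_lt_top (Measurable.iSup fun k => measurable_pathSum lam θ (2 * k) false)
      (ne_top_of_le_ne_top hC h1)
    filter_upwards [hgood, h2] with ω hω hfin t ht
    refine finite_of_truncSize_le (ENNReal.mul_ne_top hE' hfin.ne) fun k => ?_
    calc truncSize lam k t ω ≤ truncSize lam (2 * k) t ω := truncSize_mono (by omega) t ω
      _ ≤ ENNReal.ofReal (Real.exp (θ * t)) * pathSum lam θ (2 * k) false ω :=
          truncSize_le hlam.le hθ.le hω (2 * k) t
      _ ≤ _ := by
          rw [hE]
          gcongr
          · exact ht.2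
          · exact le_iSup (fun k => pathSum lam θ (2 * k) false ω) k
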